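/- Let $q$ be a prime power. For a matroid $N$ of rank $s$ on a finite set $S$ of $m$ elements: * A flag of $N$ is a chain $\mathrm{cl}(\emptyset)=X_0\subset X_1\subset\cdots\subset X_s=S$ in which $X_i$ is a flat of rank $i$; its composition is $(|X_0|,|X_1-X_0|,\ldots,|X_s-X_{s-1}|)$. An $(m,s)$-composition is a sequence $(a_0,a_1,\ldots,a_s)$ of integers with sum $m$, $a_0\ge 0$ and $a_i>0$ for $i\ge 1$. The catenary data of $N$ is the vector $\bigl(\nu(N;a_0,\ldots,a_s)\bigr)$, indexed by the $(m,s)$-compositions, where $\nu(N;a_0,\ldots,a_s)$ is the number of flags of $N$ with composition $(a_0,\ldots,a_s)$. * The rank sequence of an ordering $\pi=(e_1,\ldots,e_m)$ of $S$ is $\underline r(\pi)=r_1r_2\cdots r_m$ with $r_j=r(\{e_1,\ldots,e_j\})-r(\{e_1,\ldots,e_{j-1}\})$. With one formal symbol $[\underline r]$ for each sequence $\underline r$ of $m$ terms, $s$ of which are $1$ and $m-s$ of which are $0$, the $\mathcal G$-invariant of $N$ is the formal linear combination $\mathcal G(N)=\sum_\pi[\underline r(\pi)]$ over a fixed field of characteristic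 $0$, the sum being over all $m!$ orderings of $S$. Let $M$ be a nonempty simple $GF(q)$-representable matroid of rank $r$ with $n$ elements. A $q$-cone of $M$ is obtained as follows: choose a set $E$ of points of the projective geometry $PG(r,q)$ (which has rank $r+1$) with $PG(r,q)|E\cong M$, choose a point $a$ of $PG(r,q)$ not in the closure of $E$, let $E'$ be the union, over all $p\in E$, of the lines through $a$ and $p$, and take the restriction $PG(r,q)|E'$. **Proposition.** Let $M'$ be any $q$-cone of $M$. Then $M'$ has $qn+1$ elements and rank $r+1$, and the catenary data of $M'$ can be calculated from that of $M$: for every $(qn+1,r+1)$-composition $b$, $$\nu(M';b)=\sum_{a}\ \sum_{\substack{1\le j\le r+1\\ a^{(j)}=b}} q^{\,j-1}\,\nu(M;a),$$ where $a$ runs over the $(n,r)$-compositions and $$a^{(j)}=\bigl(a_0,a_1,\ldots,a_{j-1},\,(a_0+a_1+\cdots+a_{j-1})(q-1)+1,\,a_jq,\,a_{j+1}q,\ldots,a_rq\bigr).$$ Moreover, the $\mathcal G$-invariant of $M'$ depends only on $\mathcal G(M)$ (not on $M$ or on the chosen representation): for given $q$, $n$ and $r$ there is a function $\Phi$ such that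 $\mathcal G(M')=\Phi(\mathcal G(M))$ for every such $M$ and every $q$-cone $M'$ of $M$. -/

import Mathlib

open scoped LinearAlgebra.Projectivization

namespace QConeCatenary

/-! ### Simple matroids and isomorphisms -/

/-- A matroid is simple if it has no loops and no two parallel elements, that is, if every set of
at most two elements is independent. -/
def IsSimple {α : Type*} (M : Matroid α) : Prop :=
  ∀ I : Set α, I ⊆ M.E → I.encard ≤ 2 → M.Indep I

/-- Two matroids are isomorphic if there is a bijection between their ground sets under which
independent sets correspond to independent sets. -/
def IsIsomorphic {α β : Type*} (M : Matroid α) (N : Matroid β) : Prop :=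
  ∃ e : M.E ≃ N.E, ∀ I : Set M.E,
    M.Indep (Subtype.val '' I) ↔ N.Indep (Subtype.val '' (e '' I))

/-! ### The projective geometry as a matroid, and `q`-cones -/

/-- The matroid of the projective space `ℙ K V`: its elements are all the points, and a set of
points is independent if representative vectors of its points are linearly independent
(by `Projectivization.independent_iff` the choice of representatives is immaterial). -/
def projectiveGeometry (K V : Type*) [Field K] [AddCommGroup V] [Module K V] :
    Matroid (ℙ K V) :=
  (IndepMatroid.ofFinitaryCardAugment Set.univ
    (fun I : Set (ℙ K V) => LinearIndepOn K Projectivization.rep I)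
    (linearIndepOn_empty _ _)
    (fun _ _ hJ hIJ => hJ.mono hIJ)
    (by
      intro I J hI hIfin hJ hJfin hlt
      by_contra! hcon
      have hsub : ∀ e ∈ J, (e.rep : V) ∈ Submodule.span K (Projectivization.rep '' I) := by
        intro e he
        by_cases heI : e ∈ I
        · exact Submodule.subset_span ⟨e, heI, rfl⟩
        · by_contra hns
          exact hcon e he heI (hI.insert hns)
      have := hJfin.fintype
      have := (hIfin.image (Projectivization.rep (K := K) (V := V))).fintype
      have hfin : FiniteDimensional K (Submodule.span K (Projectivization.rep '' I)) :=
        FiniteDimensional.span_of_finite K (hIfin.image _)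
      let f : J → Submodule.span K (Projectivization.rep '' I) :=
        fun e => ⟨(e : ℙ K V).rep, hsub e e.2⟩
      have hf : LinearIndependent K f :=
        LinearIndependent.of_comp (Submodule.subtype _) hJ
      have h1 := hf.fintype_card_le_finrank
      have h2 : Module.finrank K (Submodule.span K (Projectivization.rep '' I)) ≤ I.ncard := by
        refine (finrank_span_le_card (R := K) (Projectivization.rep '' I)).trans ?_
        rw [← Set.ncard_eq_toFinset_card']
        exact Set.ncard_image_le hIfin
      rw [← Nat.card_eq_fintype_card, Nat.card_coe_set_eq] at h1
      omega)
    (fun I h => linearIndepOn_of_finite I h)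
    (fun _ _ => Set.subset_univ _)).matroid

/-- `M'` is a `q`-cone of `M` (where `q` is the number of elements of `K`): for some
representation of `M` by a set `E` of points of the projective geometry whose rank is one more than
that of `M`, and some point `a` outside the closure of `E`, the matroid `M'` is the restriction of
the projective geometry to the union of the lines through `a` and a point of `E`. -/
def IsQCone {α K V : Type*} [Field K] [AddCommGroup V] [Module K V]
    (M : Matroid α) (M' : Matroid (ℙ K V)) : Prop :=
  (Module.finrank K V : ℕ∞) = M.eRank + 1 ∧
  ∃ (E : Set (ℙ K V)) (a : ℙ K V),
    IsIsomorphic ((projectiveGeometry K V).restrict E) M ∧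
    a ∉ (projectiveGeometry K V).closure E ∧
    M' = (projectiveGeometry K V).restrict (⋃ p ∈ E, (projectiveGeometry K V).closure {a, p})

/-! ### Catenary data -/

/-- The `(n, r)`-compositions `(a₀, a₁, …, aᵣ)`: sequences of natural numbers with sum `n` whose
entries other than `a₀` are positive. -/
def compositions (n r : ℕ) : Finset (Fin (r + 1) → ℕ) :=
  {a ∈ Finset.univ.piAntidiag n | ∀ j, j ≠ 0 → 0 < a j}

/-- The type of `(n, r)`-compositions. -/
abbrev NRComposition (n r : ℕ) : Type := {a // a ∈ compositions n r}

/-- `(X₀, X₁, …, Xᵣ)` is a flag of the rank-`r` matroid `M`. -/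
structure IsFlag {α : Type*} (M : Matroid α) {r : ℕ} (X : Fin (r + 1) → Set α) : Prop where
  strictMono : StrictMono X
  isFlat : ∀ i, M.IsFlat (X i)
  eRk_eq : ∀ i, M.eRk (X i) = (i : ℕ)
  zero_eq : X 0 = M.closure ∅
  last_eq : X (Fin.last r) = M.E

/-- The composition `(|X₀|, |X₁ - X₀|, …, |Xᵣ - Xᵣ₋₁|)` of a flag. -/
noncomputable def flagComposition {α : Type*} {r : ℕ} (X : Fin (r + 1) → Set α) :
    Fin (r + 1) → ℕ :=
  Fin.cons (X 0).ncard (fun j : Fin r => (X j.succ \ X j.castSucc).ncard)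

/-- The catenary data of a rank-`r` matroid `M` on `n` elements: the number of flags with
composition `a`, for each `(n, r)`-composition `a`. -/
noncomputable def catenaryData {α : Type*} (n r : ℕ) (M : Matroid α) (a : NRComposition n r) : ℕ :=
  {X : Fin (r + 1) → Set α | IsFlag M X ∧ flagComposition X = a.1}.ncard

/-- For `a = (a₀, …, aᵣ)` and `0 ≤ j ≤ r`, the sequence
`(a₀, …, aⱼ, (q - 1)(a₀ + ⋯ + aⱼ) + 1, q aⱼ₊₁, …, q aᵣ)`. -/
def coneComposition {r : ℕ} (q : ℕ) (a : Fin (r + 1) → ℕ) (j : Fin (r + 1)) :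
    Fin (r + 1 + 1) → ℕ := fun i =>
  if h : (i : ℕ) ≤ j then a ⟨i, by omega⟩
  else if (i : ℕ) = j + 1 then (q - 1) * (∑ k ∈ Finset.Iic j, a k) + 1
  else q * a ⟨i - 1, by omega⟩

/-- The explicit calculation of the catenary data of a `q`-cone from the catenary data `ν`: every
`(n, r)`-composition `a` contributes, for `0 ≤ j ≤ r`, the amount `q ^ j * ν a` to the coordinate
`coneComposition q a j`. -/
def coneCatenaryData {n r : ℕ} (q : ℕ) (ν : NRComposition n r → ℕ) :
    NRComposition (q * n + 1) (r + 1) → ℕ := fun b =>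
  ∑ a : NRComposition n r, ∑ j : Fin (r + 1),
    if coneComposition q a.1 j = b.1 then q ^ (j : ℕ) * ν a else 0

/-! ### The `𝒢`-invariant -/

/-- The `(n, r)`-sequences: sequences of `n` terms, `r` of which are `1` and the others `0`. -/
abbrev NRSequence (n r : ℕ) : Type :=
  {s : Fin n → ℕ // (∀ i, s i = 0 ∨ s i = 1) ∧ ∑ i, s i = r}

/-- The rank sequence of an ordering `π(0), …, π(n - 1)` of the elements of `M`: its `j`-th term is
`r({π(i) : i ≤ j}) - r({π(i) : i < j})`. -/
noncomputable def rankSequence {α : Type*} {n : ℕ} (M : Matroid α) (π : Fin n ≃ M.E) : Fin n → ℕ :=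
  fun j => (M.eRk ((fun i => (π i : α)) '' Set.Iic j)).toNat
    - (M.eRk ((fun i => (π i : α)) '' Set.Iio j)).toNat

/-- The `𝒢`-invariant of a rank-`r` matroid `M` on `n` elements, as an element of the vector space
of formal linear combinations of `(n, r)`-sequences over `𝕜`. It is the sum over all `n!` orderings
`π` of the elements of `M` of the symbol of the rank sequence of `π`; so the coefficient of a symbol
is the number of orderings that have this rank sequence. -/
noncomputable def gInvariant {α : Type*} (𝕜 : Type*) [Field 𝕜] (n r : ℕ) (M : Matroid α) :
    NRSequence n r → 𝕜 :=
  fun s => (Nat.card {π : Fin n ≃ M.E // rankSequence M π = s.1} : 𝕜)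

end QConeCatenary

namespace QConeCatenary

open Module

/-! ### Partial sums of compositions -/

/-! Place the points of `M` in a hyperplane, the kernel of a functional `l`, and let `v₀` be the
apex, with `l v₀ = 1`. Flags of a represented matroid amount to chains of subspaces of dimensions 0,
1, 2, … that are spanned by the points they contain (`Represents.catenaryData_eq`), so flags of the
cone can be studied by projecting along `v₀`.

Let `Y` be such a chain for the cone, and `j + 1` the first index at which it contains `v₀`. Before
that index the projection is injective on the members of `Y`; from there on it lowers the dimension
by one. The images therefore form a flag `W` of the base, with `W j` obtained twice
(`IsConeBase.exists_isLift`). Conversely, `W` and `j` force the members of `Y` from index `j + 1` on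
to be full preimages, while the earlier ones are the graphs over `W 0`, …, `W j` of one linear
functional on `W j`; there are `q ^ j` such functionals (`IsConeBase.card_isLift`). A graph over `W
i` contains one cone point for each base point in `W i`; a preimage contains `q` for each of them,
and the apex. So partial sums `S` turn into `S 0, …, S j, q * S j + 1, …, q * S r + 1`, which are
the partial sums of `coneComposition`.

For the `𝒢`-invariant, the closures of the initial sets of an ordering form a flag, and the number
of orderings with rank sequence `s` and a given flag depends only on `s` and the composition of the
flag. Hence the `𝒢`-invariant is a linear image of the catenary data (`card_rankSequence_eq`). The
map is triangular with nonzero diagonal on suitable sequences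
(`eq_of_forall_sum_compatibleCount_eq`), so in characteristic 0 the invariant of `M` determines the
catenary data of `M`, hence those of the cone, hence the invariant of the cone. -/

/-- The partial sum `a₀ + ⋯ + aᵢ`. -/
def partialSum {r : ℕ} (a : Fin (r + 1) → ℕ) (i : Fin (r + 1)) : ℕ := ∑ k ∈ Finset.Iic i, a k

lemma partialSum_zero {r : ℕ} (a : Fin (r + 1) → ℕ) : partialSum a 0 = a 0 := by
  have : Finset.Iic (0 : Fin (r + 1)) = {0} := by ext x; simp
  simp [partialSum, this]

lemma partialSum_succ {r : ℕ} (a : Fin (r + 1) → ℕ) (i : Fin r) :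
    partialSum a i.succ = partialSum a i.castSucc + a i.succ := by
  have : Finset.Iic i.succ = insert i.succ (Finset.Iic i.castSucc) := by
    ext x; simp only [Finset.mem_Iic, Finset.mem_insert, Fin.le_def, Fin.ext_iff, Fin.val_succ,
      Fin.val_castSucc]; omega
  rw [partialSum, this, Finset.sum_insert (by simp), add_comm, partialSum]

lemma partialSum_last {r : ℕ} (a : Fin (r + 1) → ℕ) : partialSum a (Fin.last r) = ∑ k, a k := by
  have : Finset.Iic (Fin.last r) = Finset.univ := by ext x; simp [Fin.le_last]
  rw [partialSum, this]

lemma partialSum_mono {r : ℕ} (a : Fin (r + 1) → ℕ) : Monotone (partialSum a) := fun _ _ h =>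
  Finset.sum_le_sum_of_subset (Finset.Iic_subset_Iic.2 h)

lemma partialSum_injective {r : ℕ} :
    Function.Injective (partialSum : (Fin (r + 1) → ℕ) → Fin (r + 1) → ℕ) := by
  intro a b h
  funext i
  induction i using Fin.cases with
  | zero => rw [← partialSum_zero a, ← partialSum_zero b, h]
  | succ i =>
    have h1 := congrFun h i.succ
    have h2 := congrFun h i.castSucc
    rw [partialSum_succ, partialSum_succ] at h1
    omega

lemma partialSum_flagComposition {α : Type*} {r : ℕ} {X : Fin (r + 1) → Set α}
    (hX : Monotone X) (hfin : ∀ i, (X i).Finite) (i : Fin (r + 1)) :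
    partialSum (flagComposition X) i = (X i).ncard := by
  induction i using Fin.induction with
  | zero => simp [partialSum_zero, flagComposition]
  | succ i ih =>
    rw [partialSum_succ, ih, flagComposition, Fin.cons_succ, add_comm]
    exact Set.ncard_sdiff_add_ncard_of_subset (hX (Fin.castSucc_le_succ i)) (hfin _)

/-- Partial sums of the composition are the sizes of the flats themselves, which are easier to count
than the differences; compositions are compared in this form throughout. -/
lemma flagComposition_eq_iff {α : Type*} {r : ℕ} {X : Fin (r + 1) → Set α}
    (hX : Monotone X) (hfin : ∀ i, (X i).Finite) (a : Fin (r + 1) → ℕ) :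
    flagComposition X = a ↔ ∀ i, (X i).ncard = partialSum a i := by
  rw [← partialSum_injective.eq_iff, funext_iff]
  simp_rw [partialSum_flagComposition hX hfin]

lemma mem_compositions {n r : ℕ} {a : Fin (r + 1) → ℕ} :
    a ∈ compositions n r ↔ ∑ i, a i = n ∧ ∀ j, j ≠ 0 → 0 < a j := by
  simp [compositions]

lemma IsFlag.subset_ground {α : Type*} {M : Matroid α} {r : ℕ} {X : Fin (r + 1) → Set α}
    (hX : IsFlag M X) (i : Fin (r + 1)) : X i ⊆ M.E := (hX.isFlat i).subset_ground

lemma IsFlag.flagComposition_mem {α : Type*} {M : Matroid α} {n r : ℕ} {X : Fin (r + 1) → Set α}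
    (hX : IsFlag M X) (hE : M.E.encard = n) : flagComposition X ∈ compositions n r := by
  have hfin : M.E.Finite := Set.finite_of_encard_eq_coe hE
  have hf : ∀ i, (X i).Finite := fun i => hfin.subset (hX.subset_ground i)
  refine mem_compositions.2 ⟨?_, fun j hj => ?_⟩
  · rw [← partialSum_last, partialSum_flagComposition hX.strictMono.monotone hf, hX.last_eq,
      Set.ncard, hE, ENat.toNat_natCast]
  · obtain ⟨j, rfl⟩ := Fin.exists_succ_eq.2 hj
    rw [flagComposition, Fin.cons_succ, Set.ncard_pos ((hf _).sdiff)]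
    exact Set.nonempty_of_ssubset (hX.strictMono (Fin.castSucc_lt_succ))

/-! ### Represented matroids -/

variable {K V : Type*} [Field K] [AddCommGroup V] [Module K V]

/-- The map `φ` represents the matroid `N` over `K`. -/
def Represents {β : Type*} (N : Matroid β) (φ : β → V) (K : Type*) [Field K] [Module K V] : Prop :=
  ∀ I ⊆ N.E, (N.Indep I ↔ LinearIndepOn K φ I)

namespace Represents

variable {β : Type*} {N : Matroid β} {φ : β → V}

lemma mem_closure_iff_of_indep (h : Represents N φ K) {I : Set β} (hI : N.Indep I) {x : β}
    (hx : x ∈ N.E) : x ∈ N.closure I ↔ φ x ∈ Submodule.span K (φ '' I) := by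
  have hI' := (h I hI.subset_ground).1 hI
  rw [hI.mem_closure_iff', h _ (Set.insert_subset hx hI.subset_ground), linearIndepOn_insert_iff]
  simp only [hx, hI', true_and]
  by_cases hxI : x ∈ I
  · simpa [hxI] using Submodule.subset_span (Set.mem_image_of_mem φ hxI)
  · simp [hxI]

lemma span_eq_of_isBasis (h : Represents N φ K) {I X : Set β} (hI : N.IsBasis I X) :
    Submodule.span K (φ '' I) = Submodule.span K (φ '' X) := by
  refine le_antisymm (Submodule.span_mono (Set.image_mono hI.subset)) (Submodule.span_le.2 ?_)
  rintro _ ⟨x, hx, rfl⟩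
  exact (h.mem_closure_iff_of_indep hI.indep (hI.subset_ground hx)).1 (hI.subset_closure hx)

lemma closure_eq (h : Represents N φ K) {X : Set β} (hX : X ⊆ N.E) :
    N.closure X = {e ∈ N.E | φ e ∈ Submodule.span K (φ '' X)} := by
  obtain ⟨I, hI⟩ := N.exists_isBasis X
  ext x
  rw [← hI.closure_eq_closure, ← h.span_eq_of_isBasis hI]
  refine ⟨fun hx => ?_, fun hx => (h.mem_closure_iff_of_indep hI.indep hx.1).2 hx.2⟩
  have hxE := N.closure_subset_ground _ hx
  exact ⟨hxE, (h.mem_closure_iff_of_indep hI.indep hxE).1 hx⟩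

lemma eRk_eq [FiniteDimensional K V] (h : Represents N φ K) {X : Set β} (hX : X ⊆ N.E) :
    N.eRk X = finrank K (Submodule.span K (φ '' X)) := by
  obtain ⟨I, hI⟩ := N.exists_isBasis X
  have hlin := (h I hI.indep.subset_ground).1 hI.indep
  have hfin : Finite I := LinearIndependent.finite hlin
  have := Fintype.ofFinite I
  rw [hI.eRk_eq_encard, ← h.span_eq_of_isBasis hI, Set.image_eq_range, finrank_span_eq_card hlin,
    ← Nat.card_eq_fintype_card, Nat.card_coe_set_eq, Set.Finite.cast_ncard_eq (Set.toFinite I)]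

end Represents

/-- A chain of subspaces of dimensions `0, 1, …, r`, each spanned by vectors in `φ '' S`. -/
structure IsSubspaceFlag {β : Type*} (S : Set β) (φ : β → V) {r : ℕ}
    (W : Fin (r + 1) → Submodule K V) : Prop where
  monotone : Monotone W
  finrank_eq : ∀ i, finrank K (W i) = i
  span_eq : ∀ i, Submodule.span K (φ '' {e ∈ S | φ e ∈ W i}) = W i

/-- The flags of a represented matroid with composition `a` correspond to the chains of subspaces
that contain the corresponding numbers of elements. -/
lemma Represents.catenaryData_eq [FiniteDimensional K V] {β : Type*} {N : Matroid β} {φ : β → V}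
    {n r : ℕ} (h : Represents N φ K) (hE : N.E.Finite) (hr : N.eRank = r)
    (a : NRComposition n r) :
    catenaryData n r N a = {W : Fin (r + 1) → Submodule K V | IsSubspaceFlag N.E φ W ∧
      ∀ i, {e ∈ N.E | φ e ∈ W i}.ncard = partialSum a.1 i}.ncard := by
  have hflat : ∀ X : Fin (r + 1) → Set β, IsFlag N X → ∀ i,
      {e ∈ N.E | φ e ∈ Submodule.span K (φ '' X i)} = X i := fun X hX i => by
    rw [← h.closure_eq (hX.subset_ground i), (hX.isFlat i).closure]
  -- The bijection sends a flag to its spans; its inverse takes the elements whose vectors lie in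
  -- each subspace.
  refine Set.ncard_congr (fun X _ i => Submodule.span K (φ '' X i)) ?_ ?_ ?_
  · rintro X ⟨hX, hXa⟩
    rw [flagComposition_eq_iff hX.strictMono.monotone
      (fun i => hE.subset (hX.subset_ground i))] at hXa
    refine ⟨⟨fun i j hij => Submodule.span_mono (Set.image_mono (hX.strictMono.monotone hij)),
      fun i => ?_, fun i => ?_⟩, fun i => ?_⟩
    · exact_mod_cast (h.eRk_eq (hX.subset_ground i)).symm.trans (hX.eRk_eq i)
    · rw [hflat X hX i]
    · rw [hflat X hX i, hXa]
  · rintro X Y ⟨hX, -⟩ ⟨hY, -⟩ hXY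
    funext i
    rw [← hflat X hX i, ← hflat Y hY i, congrFun hXY i]
  · rintro W ⟨hW, hWa⟩
    set X : Fin (r + 1) → Set β := fun i => {e ∈ N.E | φ e ∈ W i} with hXdef
    have hsub : ∀ i, X i ⊆ N.E := fun i => Set.sep_subset _ _
    have hmono : Monotone X := fun i j hij e he => ⟨he.1, hW.monotone hij he.2⟩
    have hrk : ∀ i, N.eRk (X i) = (i : ℕ) := fun i => by
      rw [h.eRk_eq (hsub i), hW.span_eq, hW.finrank_eq]
    refine ⟨X, ⟨⟨?_, fun i => ?_, hrk, ?_, ?_⟩, ?_⟩, funext hW.span_eq⟩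
    · refine hmono.strictMono_of_injective fun i j hij => ?_
      have h1 := hrk i
      rw [hij, hrk j] at h1
      exact Fin.ext (by exact_mod_cast h1.symm)
    · rw [Matroid.isFlat_iff_closure_eq, h.closure_eq (hsub i), hW.span_eq]
    · have h0 : W 0 = ⊥ := Submodule.finrank_eq_zero.1 (by simpa using hW.finrank_eq 0)
      rw [h.closure_eq (Set.empty_subset _), hXdef]
      simp [h0]
    · have hle : W (Fin.last r) ≤ Submodule.span K (φ '' N.E) := by
        rw [← hW.span_eq]; exact Submodule.span_mono (Set.image_mono (hsub _))
      -- The last subspace has dimension `r`, the dimension of the span of all the elements.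
      have heq : W (Fin.last r) = Submodule.span K (φ '' N.E) := by
        refine Submodule.eq_of_le_of_finrank_eq hle ?_
        rw [hW.finrank_eq]
        rw [← N.eRk_ground, h.eRk_eq subset_rfl] at hr
        exact_mod_cast hr.symm
      refine Set.Subset.antisymm (hsub _) fun e he => ⟨he, ?_⟩
      rw [heq]
      exact Submodule.subset_span ⟨e, he, rfl⟩
    · exact (flagComposition_eq_iff hmono (fun i => hE.subset (hsub i)) _).2 hWa

end QConeCatenary

namespace QConeCatenary

open Module

/-! ### Cones in linear algebra -/

variable {K V α : Type*} [Field K] [AddCommGroup V] [Module K V]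

/-- The vectors `φ x`, `x ∈ E`, represent distinct points in the kernel of the functional `l`, and
`l` takes the value `1` at the vector `v₀`, the apex. -/
structure IsConeBase (E : Set α) (φ : α → V) (l : V →ₗ[K] K) (v₀ : V) : Prop where
  apex : l v₀ = 1
  base : ∀ x ∈ E, l (φ x) = 0
  ne_zero : ∀ x ∈ E, φ x ≠ 0
  eq_of_smul_eq : ∀ x ∈ E, ∀ y ∈ E, ∀ c : K, c • φ x = φ y → x = y
  nonempty : E.Nonempty

/-- The projection onto the kernel of `l` along `v₀`. -/
def proj (l : V →ₗ[K] K) (v₀ : V) : V →ₗ[K] V := LinearMap.id - l.smulRight v₀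

/-- The map `v ↦ v + F v • v₀`. -/
def shear (F : V →ₗ[K] K) (v₀ : V) : V →ₗ[K] V := LinearMap.id + F.smulRight v₀

/-- The points of the cone over the points `φ x`, `x ∈ E`. -/
def conePoints (E : Set α) (φ : α → V) (l : V →ₗ[K] K) (v₀ : V) : Set (ℙ K V) :=
  {p | ∃ x ∈ E, proj l v₀ p.rep ∈ Submodule.span K {φ x}}

lemma proj_apply (l : V →ₗ[K] K) (v₀ v : V) : proj l v₀ v = v - l v • v₀ := rfl

lemma shear_apply (F : V →ₗ[K] K) (v₀ v : V) : shear F v₀ v = v + F v • v₀ := rfl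

lemma proj_add_smul (l : V →ₗ[K] K) (v₀ v : V) : proj l v₀ v + l v • v₀ = v := by
  rw [proj_apply, sub_add_cancel]

lemma rep_mk_mem_iff {v : V} (hv : v ≠ 0) (Y : Submodule K V) :
    (Projectivization.mk K v hv).rep ∈ Y ↔ v ∈ Y := by
  obtain ⟨u, hu⟩ := Projectivization.exists_smul_eq_mk_rep K v hv
  rw [← hu]
  exact Submodule.smul_mem_iff'' Y

namespace IsConeBase

variable {E : Set α} {φ : α → V} {l : V →ₗ[K] K} {v₀ : V}

lemma apex_ne_zero (h : IsConeBase E φ l v₀) : v₀ ≠ 0 := by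
  rintro rfl; simpa using h.apex

lemma proj_apex (h : IsConeBase E φ l v₀) : proj l v₀ v₀ = 0 := by
  simp [proj_apply, h.apex]

lemma proj_of_eq_zero {v : V} (hv : l v = 0) : proj l v₀ v = v := by
  simp [proj_apply, hv]

lemma proj_shear (h : IsConeBase E φ l v₀) (F : V →ₗ[K] K) {v : V} (hv : l v = 0) :
    proj l v₀ (shear F v₀ v) = v := by
  simp [proj_apply, shear_apply, hv, h.apex]

lemma mk_mem_conePoints {v : V} (hv : v ≠ 0) :
    Projectivization.mk K v hv ∈ conePoints E φ l v₀ ↔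
      ∃ x ∈ E, proj l v₀ v ∈ Submodule.span K {φ x} := by
  refine exists_congr fun x => and_congr_right fun _ => ?_
  exact rep_mk_mem_iff hv ((Submodule.span K {φ x}).comap (proj l v₀))

/-- Such a vector is either zero or represents a cone point lying in `Y`. This is the tool for
showing that lifted subspaces are spanned by cone points. -/
lemma mem_span_rep {Y : Submodule K V} {v : V} (hvY : v ∈ Y)
    (hv : ∃ x ∈ E, proj l v₀ v ∈ Submodule.span K {φ x}) :
    v ∈ Submodule.span K (Projectivization.rep '' {p ∈ conePoints E φ l v₀ | p.rep ∈ Y}) := by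
  by_cases h0 : v = 0
  · simp [h0]
  · rw [← rep_mk_mem_iff h0]
    exact Submodule.subset_span ⟨_, ⟨(mk_mem_conePoints h0).2 hv, (rep_mk_mem_iff h0 Y).2 hvY⟩, rfl⟩

/-! ### Subspaces spanned by base points or by cone points -/

lemma span_rep_le (Y : Submodule K V) (S : Set (ℙ K V)) :
    Submodule.span K (Projectivization.rep '' {p ∈ S | p.rep ∈ Y}) ≤ Y := by
  rw [Submodule.span_le]; rintro _ ⟨p, hp, rfl⟩; exact hp.2

/-- The projection of a subspace spanned by cone points is spanned by base points. -/
lemma span_map_proj {Y : Submodule K V}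
    (hY : Submodule.span K (Projectivization.rep '' {p ∈ conePoints E φ l v₀ | p.rep ∈ Y}) = Y) :
    Submodule.span K (φ '' {x ∈ E | φ x ∈ Y.map (proj l v₀)}) = Y.map (proj l v₀) := by
  apply le_antisymm
  · rw [Submodule.span_le]; rintro _ ⟨x, hx, rfl⟩; exact hx.2
  · conv_lhs => rw [← hY]
    rw [Submodule.map_span, Submodule.span_le]
    rintro _ ⟨_, ⟨p, ⟨⟨x, hx, hp⟩, hpY⟩, rfl⟩, rfl⟩
    obtain ⟨c, hc⟩ := Submodule.mem_span_singleton.1 hp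
    by_cases h0 : c = 0
    · rw [← hc, h0, zero_smul]; exact zero_mem _
    · have hx' : φ x ∈ Y.map (proj l v₀) := by
        rw [← Submodule.smul_mem_iff _ h0, hc]; exact Submodule.mem_map_of_mem hpY
      rw [← hc]
      exact Submodule.smul_mem _ _ (Submodule.subset_span ⟨x, ⟨hx, hx'⟩, rfl⟩)

lemma le_ker (h : IsConeBase E φ l v₀) {W : Submodule K V}
    (hW : Submodule.span K (φ '' {x ∈ E | φ x ∈ W}) = W) {w : V} (hw : w ∈ W) : l w = 0 := by
  have : W ≤ LinearMap.ker l := by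
    rw [← hW, Submodule.span_le]; rintro _ ⟨x, hx, rfl⟩; exact h.base x hx.1
  exact this hw

/-- The sheared base vectors still project to base vectors, so they represent cone points, and they
span the image. -/
lemma span_map_shear (h : IsConeBase E φ l v₀) (F : V →ₗ[K] K) {W : Submodule K V}
    (hW : Submodule.span K (φ '' {x ∈ E | φ x ∈ W}) = W) :
    Submodule.span K (Projectivization.rep ''
      {p ∈ conePoints E φ l v₀ | p.rep ∈ W.map (shear F v₀)}) = W.map (shear F v₀) := by
  apply le_antisymm (span_rep_le _ _)
  conv_lhs => rw [← hW]
  rw [Submodule.map_span, Submodule.span_le]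
  rintro _ ⟨_, ⟨x, ⟨hx, hxW⟩, rfl⟩, rfl⟩
  refine mem_span_rep (Submodule.mem_map_of_mem hxW) ⟨x, hx, ?_⟩
  rw [h.proj_shear F (h.base x hx)]
  exact Submodule.mem_span_singleton_self _

/-- Each vector is its projection plus a multiple of `v₀`; `W` is spanned by base vectors, and both
these and the apex represent cone points. -/
lemma span_comap_proj (h : IsConeBase E φ l v₀) {W : Submodule K V}
    (hW : Submodule.span K (φ '' {x ∈ E | φ x ∈ W}) = W) :
    Submodule.span K (Projectivization.rep ''
      {p ∈ conePoints E φ l v₀ | p.rep ∈ W.comap (proj l v₀)}) = W.comap (proj l v₀) := by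
  apply le_antisymm (span_rep_le _ _)
  have hle : W ≤ Submodule.span K (Projectivization.rep ''
      {p ∈ conePoints E φ l v₀ | p.rep ∈ W.comap (proj l v₀)}) := by
    conv_lhs => rw [← hW]
    rw [Submodule.span_le]
    rintro _ ⟨x, ⟨hx, hxW⟩, rfl⟩
    have hp := proj_of_eq_zero (v₀ := v₀) (h.base x hx)
    refine mem_span_rep ?_ ⟨x, hx, ?_⟩
    · rwa [Submodule.mem_comap, hp]
    · rw [hp]; exact Submodule.mem_span_singleton_self _
  intro v hv
  rw [← proj_add_smul l v₀ v]
  refine add_mem (hle hv) (Submodule.smul_mem _ _ ?_)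
  -- The apex belongs to the cone only because there is at least one base point to join it to.
  obtain ⟨x, hx⟩ := h.nonempty
  refine mem_span_rep ?_ ⟨x, hx, ?_⟩
  · rw [Submodule.mem_comap, h.proj_apex]; exact zero_mem _
  · rw [h.proj_apex]; exact zero_mem _

/-! ### Projections, apex membership and dimensions of lifted subspaces -/

lemma map_proj_map_shear (h : IsConeBase E φ l v₀) (F : V →ₗ[K] K) {W : Submodule K V}
    (hW : ∀ w ∈ W, l w = 0) : (W.map (shear F v₀)).map (proj l v₀) = W := by
  ext v
  simp only [Submodule.mem_map, exists_exists_and_eq_and]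
  constructor
  · rintro ⟨w, hw, rfl⟩; rwa [h.proj_shear F (hW w hw)]
  · exact fun hv => ⟨v, hv, h.proj_shear F (hW v hv)⟩

lemma map_proj_comap_proj {W : Submodule K V}
    (hW : ∀ w ∈ W, l w = 0) : (W.comap (proj l v₀)).map (proj l v₀) = W := by
  refine le_antisymm (Submodule.map_comap_le _ _) fun w hw => ?_
  have := proj_of_eq_zero (v₀ := v₀) (hW w hw)
  exact ⟨w, by simpa [this] using hw, this⟩

lemma apex_mem_comap_proj (h : IsConeBase E φ l v₀) (W : Submodule K V) :
    v₀ ∈ W.comap (proj l v₀) := by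
  rw [Submodule.mem_comap, h.proj_apex]; exact zero_mem _

lemma apex_notMem_map_shear (h : IsConeBase E φ l v₀) (F : V →ₗ[K] K) {W : Submodule K V}
    (hW : ∀ w ∈ W, l w = 0) : v₀ ∉ W.map (shear F v₀) := by
  rintro ⟨w, hw, hwv⟩
  have h1 := h.proj_shear F (hW w hw)
  rw [hwv, h.proj_apex] at h1
  rw [← h1, map_zero] at hwv
  exact h.apex_ne_zero hwv.symm

lemma smul_apex_of_proj_eq_zero {v : V} (hv : proj l v₀ v = 0) : v = l v • v₀ := by
  conv_lhs => rw [← proj_add_smul l v₀ v, hv, zero_add]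

lemma injective_proj_domRestrict {Y : Submodule K V} (hY : v₀ ∉ Y) :
    LinearMap.ker ((proj l v₀).domRestrict Y) = ⊥ := by
  rw [LinearMap.ker_eq_bot']
  rintro ⟨y, hy⟩ hy0
  have h1 : y = l y • v₀ := smul_apex_of_proj_eq_zero hy0
  by_cases hl : l y = 0
  · rw [hl, zero_smul] at h1; exact Subtype.ext h1
  · rw [h1, Submodule.smul_mem_iff _ hl] at hy
    exact absurd hy hY

lemma finrank_map_proj_of_notMem [FiniteDimensional K V] {Y : Submodule K V} (hY : v₀ ∉ Y) :
    finrank K (Y.map (proj l v₀)) = finrank K Y := by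
  rw [← LinearMap.range_domRestrict]
  exact LinearMap.finrank_range_of_inj (LinearMap.ker_eq_bot.1 (injective_proj_domRestrict hY))

/-- If `v₀ ∈ Y`, then `Y` is the direct sum of its projection, on which `l` vanishes, and the line
of `v₀`. -/
lemma finrank_map_proj_of_mem [FiniteDimensional K V] (h : IsConeBase E φ l v₀)
    {Y : Submodule K V} (hY : v₀ ∈ Y) :
    finrank K (Y.map (proj l v₀)) + 1 = finrank K Y := by
  have hsup : Y.map (proj l v₀) ⊔ Submodule.span K {v₀} = Y := by
    apply le_antisymm
    · refine sup_le ?_ ((Submodule.span_singleton_le_iff_mem _ _).2 hY)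
      rintro _ ⟨y, hy, rfl⟩
      exact sub_mem hy (Submodule.smul_mem _ _ hY)
    · intro y hy
      rw [← proj_add_smul l v₀ y]
      exact Submodule.add_mem_sup (Submodule.mem_map_of_mem hy)
        (Submodule.smul_mem _ _ (Submodule.mem_span_singleton_self _))
  have hinf : Y.map (proj l v₀) ⊓ Submodule.span K {v₀} = ⊥ := by
    rw [eq_bot_iff]
    rintro _ ⟨⟨y, hy, rfl⟩, hv⟩
    obtain ⟨c, hc⟩ := Submodule.mem_span_singleton.1 hv
    have h1 : l (proj l v₀ y) = 0 := by simp [proj_apply, h.apex]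
    rw [← hc, map_smul, h.apex, smul_eq_mul, mul_one] at h1
    rw [← hc, h1, zero_smul]; exact zero_mem _
  have := Submodule.finrank_sup_add_finrank_inf_eq (Y.map (proj l v₀)) (Submodule.span K {v₀})
  rw [hsup, hinf, finrank_bot, finrank_span_singleton h.apex_ne_zero] at this
  omega

/-! ### Counting the points of the cone -/

lemma exists_smul_eq {v : V} {x : α} (hv : proj l v₀ v ≠ 0)
    (hx : proj l v₀ v ∈ Submodule.span K {φ x}) : ∃ c : K, c ≠ 0 ∧ c • φ x = proj l v₀ v := by
  obtain ⟨c, hc⟩ := Submodule.mem_span_singleton.1 hx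
  refine ⟨c, ?_, hc⟩
  rintro rfl
  exact hv (by rw [← hc, zero_smul])

/-- The graph of a functional over `W` meets the line joining the apex to a base point in `W` in
exactly one point, represented by the sheared base vector. -/
lemma ncard_map_shear (h : IsConeBase E φ l v₀) (F : V →ₗ[K] K) {W : Submodule K V}
    (hW : ∀ w ∈ W, l w = 0) :
    {p ∈ conePoints E φ l v₀ | p.rep ∈ W.map (shear F v₀)}.ncard = {x ∈ E | φ x ∈ W}.ncard := by
  have hne : ∀ x ∈ {x ∈ E | φ x ∈ W}, shear F v₀ (φ x) ≠ 0 := fun x hx h0 => by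
    have h1 := h.proj_shear F (h.base x hx.1)
    rw [h0, map_zero] at h1
    exact h.ne_zero x hx.1 h1.symm
  symm
  refine Set.ncard_congr (fun x hx => Projectivization.mk K _ (hne x hx)) ?_ ?_ ?_
  · intro x hx
    refine ⟨(mk_mem_conePoints _).2 ⟨x, hx.1, ?_⟩, (rep_mk_mem_iff _ _).2
      (Submodule.mem_map_of_mem hx.2)⟩
    rw [h.proj_shear F (h.base x hx.1)]
    exact Submodule.mem_span_singleton_self _
  · intro x y hx hy hxy
    obtain ⟨c, hc⟩ := (Projectivization.mk_eq_mk_iff' K _ _ _ _).1 hxy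
    have h1 := congrArg (proj l v₀) hc
    rw [map_smul, h.proj_shear F (h.base x hx.1), h.proj_shear F (h.base y hy.1)] at h1
    exact (h.eq_of_smul_eq y hy.1 x hx.1 c h1).symm
  · rintro p ⟨⟨x, hx, hp⟩, w, hw, hwp⟩
    have hPw : proj l v₀ p.rep = w := by rw [← hwp, h.proj_shear F (hW w hw)]
    have hw0 : w ≠ 0 := by
      rintro rfl
      exact p.rep_nonzero (by rw [← hwp, map_zero])
    obtain ⟨c, hc, hcx⟩ := exists_smul_eq (hPw ▸ hw0) hp
    rw [hPw] at hcx
    have hxW : φ x ∈ W := by rwa [← Submodule.smul_mem_iff _ hc, hcx]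
    refine ⟨x, ⟨hx, hxW⟩, ?_⟩
    conv_rhs => rw [← p.mk_rep]
    rw [Projectivization.mk_eq_mk_iff']
    refine ⟨c⁻¹, ?_⟩
    rw [← hwp, ← hcx, map_smul, smul_smul, inv_mul_cancel₀ hc, one_smul]

/-- Apart from the apex, the points are those of the vectors `φ x + t • v₀` with `φ x ∈ W` and `t`
in `K`, and distinct pairs `(x, t)` give distinct points. -/
lemma ncard_comap_proj [Finite K] [FiniteDimensional K V] (h : IsConeBase E φ l v₀)
    {W : Submodule K V} :
    {p ∈ conePoints E φ l v₀ | p.rep ∈ W.comap (proj l v₀)}.ncard =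
      Nat.card K * {x ∈ E | φ x ∈ W}.ncard + 1 := by
  have hVfin : Finite V := Module.finite_of_finite K
  have hne : ∀ x ∈ E, ∀ t : K, φ x + t • v₀ ≠ 0 := fun x hx t h0 => by
    have h1 : proj l v₀ (φ x + t • v₀) = φ x := by
      rw [map_add, map_smul, h.proj_apex, smul_zero, add_zero, proj_of_eq_zero (h.base x hx)]
    rw [h0, map_zero] at h1
    exact h.ne_zero x hx h1.symm
  have hproj : ∀ x ∈ E, ∀ t : K, proj l v₀ (φ x + t • v₀) = φ x := fun x hx t => by
    rw [map_add, map_smul, h.proj_apex, smul_zero, add_zero, proj_of_eq_zero (h.base x hx)]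
  set T : Set (ℙ K V) := {p ∈ conePoints E φ l v₀ | p.rep ∈ W.comap (proj l v₀) ∧
    proj l v₀ p.rep ≠ 0} with hT
  have happ : Projectivization.mk K v₀ h.apex_ne_zero ∉ T := fun hmem => by
    refine hmem.2.2 ?_
    have := (rep_mk_mem_iff h.apex_ne_zero (LinearMap.ker (proj l v₀))).2 h.proj_apex
    exact this
  have hset : {p ∈ conePoints E φ l v₀ | p.rep ∈ W.comap (proj l v₀)} =
      insert (Projectivization.mk K v₀ h.apex_ne_zero) T := by
    ext p
    constructor
    · rintro ⟨hp, hpW⟩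
      by_cases h0 : proj l v₀ p.rep = 0
      · left
        conv_lhs => rw [← p.mk_rep]
        exact (Projectivization.mk_eq_mk_iff' K _ _ _ _).2
          ⟨_, (smul_apex_of_proj_eq_zero h0).symm⟩
      · exact Or.inr ⟨hp, hpW, h0⟩
    · rintro (rfl | ⟨hp, hpW, -⟩)
      · refine ⟨?_, (rep_mk_mem_iff _ _).2 (h.apex_mem_comap_proj W)⟩
        obtain ⟨x, hx⟩ := h.nonempty
        exact (mk_mem_conePoints _).2 ⟨x, hx, by rw [h.proj_apex]; exact zero_mem _⟩
      · exact ⟨hp, hpW⟩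
  rw [hset, Set.ncard_insert_of_notMem happ (Set.toFinite _), mul_comm, ← Set.ncard_univ,
    ← Set.ncard_prod]
  congr 1
  symm
  refine Set.ncard_congr (fun xt hxt => Projectivization.mk K _ (hne xt.1 hxt.1.1 xt.2)) ?_ ?_ ?_
  · rintro ⟨x, t⟩ ⟨⟨hx, hxW⟩, -⟩
    refine ⟨(mk_mem_conePoints _).2 ⟨x, hx, ?_⟩, (rep_mk_mem_iff _ _).2 ?_, fun h0 => ?_⟩
    · rw [hproj x hx]; exact Submodule.mem_span_singleton_self _
    · rwa [Submodule.mem_comap, hproj x hx]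
    · have := (rep_mk_mem_iff (hne x hx t) (LinearMap.ker (proj l v₀))).1 h0
      rw [LinearMap.mem_ker, hproj x hx] at this
      exact h.ne_zero x hx this
  · rintro ⟨x, t⟩ ⟨y, s⟩ ⟨⟨hx, _⟩, _⟩ ⟨⟨hy, _⟩, _⟩ hxy
    obtain ⟨c, hc⟩ := (Projectivization.mk_eq_mk_iff' K _ _ _ _).1 hxy
    simp only at hx hy hc
    have h1 := congrArg (proj l v₀) hc
    rw [map_smul, hproj x hx, hproj y hy] at h1
    obtain rfl := h.eq_of_smul_eq y hy x hx c h1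
    have hc1 : c = 1 := by
      rw [← sub_eq_zero]
      refine (smul_eq_zero.1 (?_ : (c - 1) • φ y = 0)).resolve_right (h.ne_zero y hx)
      rw [sub_smul, one_smul, h1, sub_self]
    rw [hc1, one_smul, add_right_inj] at hc
    have h2 := congrArg l hc
    rw [map_smul, map_smul, h.apex, smul_eq_mul, smul_eq_mul, mul_one, mul_one] at h2
    rw [h2]
  · rintro p ⟨⟨x, hx, hp⟩, hpW, hp0⟩
    obtain ⟨c, hc, hcx⟩ := exists_smul_eq hp0 hp
    have hxW : φ x ∈ W := by rw [← Submodule.smul_mem_iff _ hc, hcx]; exact hpW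
    -- The representative is `c • φ x + l p.rep • v₀`; dividing by `c` normalises the coefficient of
    -- `φ x` to 1.
    refine ⟨(x, c⁻¹ * l p.rep), ⟨⟨hx, hxW⟩, trivial⟩, ?_⟩
    conv_rhs => rw [← p.mk_rep]
    rw [Projectivization.mk_eq_mk_iff']
    refine ⟨c⁻¹, ?_⟩
    conv_lhs => rw [← proj_add_smul l v₀ p.rep, ← hcx, smul_add, smul_smul, inv_mul_cancel₀ hc,
      one_smul, smul_smul]

end IsConeBase

end QConeCatenary

namespace QConeCatenary

open Module

/-! ### The partial sums of the composition of a cone -/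

/-- Splits the indices of a chain of the cone at the place where the apex enters: `castSucc i`
before it, `succ i` after it, both matched with the index `i` of the base. -/
lemma exists_castSucc_or_succ {r : ℕ} (j : Fin (r + 1)) (k : Fin (r + 2)) :
    (∃ i ≤ j, k = Fin.castSucc i) ∨ ∃ i, j ≤ i ∧ k = Fin.succ i := by
  by_cases h : (k : ℕ) ≤ j
  · exact Or.inl ⟨⟨k, by omega⟩, h, rfl⟩
  · refine Or.inr ⟨⟨k - 1, by omega⟩, ?_, ?_⟩
    · rw [Fin.le_def]; simp only; omega
    · rw [Fin.ext_iff]; simp only [Fin.val_succ]; omega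

lemma coneComposition_castSucc {r : ℕ} (q : ℕ) (a : Fin (r + 1) → ℕ) {i j : Fin (r + 1)}
    (h : i ≤ j) : coneComposition q a j i.castSucc = a i := by
  have : (i : ℕ) ≤ j := h
  simp [coneComposition, this]

lemma coneComposition_succ_self {r : ℕ} (q : ℕ) (a : Fin (r + 1) → ℕ) (j : Fin (r + 1)) :
    coneComposition q a j j.succ = (q - 1) * partialSum a j + 1 := by
  simp [coneComposition, partialSum]

lemma coneComposition_succ {r : ℕ} (q : ℕ) (a : Fin (r + 1) → ℕ) {i j : Fin (r + 1)}
    (h : j < i) : coneComposition q a j i.succ = q * a i := by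
  have h' : (j : ℕ) < i := h
  have h1 : ¬ (i : ℕ) + 1 ≤ j := by omega
  have h2 : (i : ℕ) ≠ j := by omega
  simp [coneComposition, h1, h2]

lemma partialSum_coneComposition_castSucc {r : ℕ} (q : ℕ) (a : Fin (r + 1) → ℕ)
    (i j : Fin (r + 1)) (h : i ≤ j) :
    partialSum (coneComposition q a j) i.castSucc = partialSum a i := by
  induction i using Fin.induction with
  | zero =>
    rw [Fin.castSucc_zero, partialSum_zero, partialSum_zero, ← Fin.castSucc_zero,
      coneComposition_castSucc _ _ h]
  | succ i ih =>
    rw [partialSum_succ, ← ih ((Fin.castSucc_le_succ i).trans h), ← Fin.succ_castSucc,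
      partialSum_succ, Fin.succ_castSucc, coneComposition_castSucc _ _ h]

/-- With `S` the partial sum up to `j`, the inserted entry gives `S + ((q - 1) * S + 1) = q * S +
1`, and every later increment is multiplied by `q`. -/
lemma partialSum_coneComposition_succ {r : ℕ} {q : ℕ} (hq : 0 < q) (a : Fin (r + 1) → ℕ)
    (i j : Fin (r + 1)) (h : j ≤ i) :
    partialSum (coneComposition q a j) i.succ = q * partialSum a i + 1 := by
  have hself : partialSum (coneComposition q a j) j.succ = q * partialSum a j + 1 := by
    rw [partialSum_succ, partialSum_coneComposition_castSucc _ _ _ _ le_rfl,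
      coneComposition_succ_self]
    obtain ⟨q, rfl⟩ := Nat.exists_eq_succ_of_ne_zero hq.ne'
    simp only [Nat.succ_eq_add_one, Nat.add_sub_cancel]
    ring
  induction i using Fin.induction with
  | zero => obtain rfl := Fin.le_zero_iff.1 h; exact hself
  | succ i ih =>
    rcases h.eq_or_lt with rfl | hlt
    · exact hself
    · rw [partialSum_succ, ← Fin.succ_castSucc, ih (Fin.le_castSucc_iff.2 hlt),
        coneComposition_succ _ _ hlt, partialSum_succ a i]
      ring

lemma forall_eq_partialSum_coneComposition_iff {r q : ℕ} (hq : 0 < q) (a : Fin (r + 1) → ℕ)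
    (j : Fin (r + 1)) (b : Fin (r + 2) → ℕ) (c : Fin (r + 2) → ℕ)
    (hc₁ : ∀ i ≤ j, c i.castSucc = partialSum a i)
    (hc₂ : ∀ i, j ≤ i → c i.succ = q * partialSum a i + 1) :
    (∀ k, c k = partialSum b k) ↔ coneComposition q a j = b := by
  have : c = partialSum (coneComposition q a j) := by
    funext k
    rcases exists_castSucc_or_succ j k with ⟨i, hi, rfl⟩ | ⟨i, hi, rfl⟩
    · rw [hc₁ i hi, partialSum_coneComposition_castSucc _ _ _ _ hi]
    · rw [hc₂ i hi, partialSum_coneComposition_succ hq _ _ _ hi]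
  rw [← funext_iff, this, partialSum_injective.eq_iff]

/-! ### Flags of the cone -/

variable {K V α : Type*} [Field K] [AddCommGroup V] [Module K V]

/-- `Y` is a flag of the cone that projects to the flag `W` of the base, and `j + 1` is the first
index at which it contains the apex. -/
structure IsLift (E : Set α) (φ : α → V) (l : V →ₗ[K] K) (v₀ : V) {r : ℕ}
    (W : Fin (r + 1) → Submodule K V) (j : Fin (r + 1)) (Y : Fin (r + 2) → Submodule K V) :
    Prop where
  isSubspaceFlag : IsSubspaceFlag (conePoints E φ l v₀) Projectivization.rep Y
  apex_notMem : ∀ i ≤ j, v₀ ∉ Y i.castSucc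
  map_castSucc : ∀ i ≤ j, (Y i.castSucc).map (proj l v₀) = W i
  apex_mem : ∀ i, j ≤ i → v₀ ∈ Y i.succ
  map_succ : ∀ i, j ≤ i → (Y i.succ).map (proj l v₀) = W i

/-- The flag of the cone that lifts `W` by means of the functional `F`. -/
def liftFlag (l : V →ₗ[K] K) (v₀ : V) {r : ℕ} (W : Fin (r + 1) → Submodule K V) (j : Fin (r + 1))
    (F : V →ₗ[K] K) : Fin (r + 2) → Submodule K V := fun k =>
  if h : (k : ℕ) ≤ j then (W ⟨k, by omega⟩).map (shear F v₀)
  else (W ⟨k - 1, by omega⟩).comap (proj l v₀)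

lemma liftFlag_castSucc (l : V →ₗ[K] K) (v₀ : V) {r : ℕ} (W : Fin (r + 1) → Submodule K V)
    {i j : Fin (r + 1)} (F : V →ₗ[K] K) (h : i ≤ j) :
    liftFlag l v₀ W j F i.castSucc = (W i).map (shear F v₀) := by
  have : (i : ℕ) ≤ j := h
  simp [liftFlag, this]

lemma liftFlag_succ (l : V →ₗ[K] K) (v₀ : V) {r : ℕ} (W : Fin (r + 1) → Submodule K V)
    {i j : Fin (r + 1)} (F : V →ₗ[K] K) (h : j ≤ i) :
    liftFlag l v₀ W j F i.succ = (W i).comap (proj l v₀) := by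
  have : ¬ (i : ℕ) + 1 ≤ j := by have : (j : ℕ) ≤ i := h; omega
  simp [liftFlag, this]

namespace IsConeBase

variable {E : Set α} {φ : α → V} {l : V →ₗ[K] K} {v₀ : V}

/-- Graphs of one functional over increasing subspaces are nested, a graph over `W i` lies in the
preimage of `W i`, and projecting either gives back `W i`. -/
lemma isLift_liftFlag [FiniteDimensional K V] (h : IsConeBase E φ l v₀) {r : ℕ}
    {W : Fin (r + 1) → Submodule K V} (hW : IsSubspaceFlag E φ W) (j : Fin (r + 1))
    (F : V →ₗ[K] K) : IsLift E φ l v₀ W j (liftFlag l v₀ W j F) := by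
  have hker : ∀ i, ∀ w ∈ W i, l w = 0 := fun i w hw => h.le_ker (hW.span_eq i) hw
  have hnot : ∀ i, v₀ ∉ (W i).map (shear F v₀) := fun i => h.apex_notMem_map_shear F (hker i)
  refine ⟨⟨?_, ?_, ?_⟩, ?_, ?_, ?_, ?_⟩
  · intro k k' hk
    rcases exists_castSucc_or_succ j k with ⟨i, hi, rfl⟩ | ⟨i, hi, rfl⟩ <;>
    rcases exists_castSucc_or_succ j k' with ⟨i', hi', rfl⟩ | ⟨i', hi', rfl⟩
    · rw [liftFlag_castSucc _ _ _ _ hi, liftFlag_castSucc _ _ _ _ hi']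
      exact Submodule.map_mono (hW.monotone hk)
    · rw [liftFlag_castSucc _ _ _ _ hi, liftFlag_succ _ _ _ _ hi', ← Submodule.map_le_iff_le_comap,
        h.map_proj_map_shear F (hker i)]
      exact hW.monotone (hi.trans hi')
    · simp only [Fin.le_def, Fin.val_succ, Fin.val_castSucc] at hk hi hi'
      omega
    · rw [liftFlag_succ _ _ _ _ hi, liftFlag_succ _ _ _ _ hi']
      exact Submodule.comap_mono (hW.monotone (Fin.succ_le_succ_iff.1 hk))
  · intro k
    rcases exists_castSucc_or_succ j k with ⟨i, hi, rfl⟩ | ⟨i, hi, rfl⟩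
    · rw [liftFlag_castSucc _ _ _ _ hi, ← finrank_map_proj_of_notMem (l := l) (hnot i),
        h.map_proj_map_shear F (hker i), hW.finrank_eq, Fin.val_castSucc]
    · rw [liftFlag_succ _ _ _ _ hi, ← h.finrank_map_proj_of_mem (h.apex_mem_comap_proj _),
        map_proj_comap_proj (hker i), hW.finrank_eq, Fin.val_succ]
  · intro k
    rcases exists_castSucc_or_succ j k with ⟨i, hi, rfl⟩ | ⟨i, hi, rfl⟩
    · rw [liftFlag_castSucc _ _ _ _ hi, h.span_map_shear F (hW.span_eq i)]
    · rw [liftFlag_succ _ _ _ _ hi, h.span_comap_proj (hW.span_eq i)]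
  · intro i hi
    rw [liftFlag_castSucc _ _ _ _ hi]
    exact hnot i
  · intro i hi
    rw [liftFlag_castSucc _ _ _ _ hi, h.map_proj_map_shear F (hker i)]
  · intro i hi
    rw [liftFlag_succ _ _ _ _ hi]
    exact h.apex_mem_comap_proj _
  · intro i hi
    rw [liftFlag_succ _ _ _ _ hi, map_proj_comap_proj (hker i)]

/-- Since `Y j.castSucc` misses the apex, projection is injective on it, so it is a graph; the
earlier members are its restrictions. The later members contain the kernel of the projection, so
they are full preimages. -/
lemma exists_eq_liftFlag {r : ℕ} {W : Fin (r + 1) → Submodule K V} {j : Fin (r + 1)}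
    {Y : Fin (r + 2) → Submodule K V} (hY : IsLift E φ l v₀ W j Y) :
    ∃ F : V →ₗ[K] K, liftFlag l v₀ W j F = Y := by
  obtain ⟨g, hg⟩ := ((proj l v₀).domRestrict (Y j.castSucc)).exists_leftInverse_of_injective
    (injective_proj_domRestrict (hY.apex_notMem j le_rfl))
  -- For `v` in `Y j.castSucc`, `F` sends the projection of `v` to `l v`, the coefficient of `v₀`
  -- that projecting removed.
  set F : V →ₗ[K] K := l ∘ₗ (Y j.castSucc).subtype ∘ₗ g
  have hF : ∀ v ∈ Y j.castSucc, shear F v₀ (proj l v₀ v) = v := fun v hv => by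
    have h1 : g (proj l v₀ v) = ⟨v, hv⟩ := LinearMap.congr_fun hg ⟨v, hv⟩
    have h2 : F (proj l v₀ v) = l v := by simp [F, h1]
    rw [shear_apply, h2, proj_add_smul]
  refine ⟨F, funext fun k => ?_⟩
  rcases exists_castSucc_or_succ j k with ⟨i, hi, rfl⟩ | ⟨i, hi, rfl⟩
  · have hle : Y i.castSucc ≤ Y j.castSucc := hY.isSubspaceFlag.monotone hi
    rw [liftFlag_castSucc _ _ _ _ hi, ← hY.map_castSucc i hi]
    ext v
    simp only [Submodule.mem_map, exists_exists_and_eq_and]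
    constructor
    · rintro ⟨w, hw, rfl⟩; rwa [hF w (hle hw)]
    · exact fun hv => ⟨v, hv, hF v (hle hv)⟩
  · rw [liftFlag_succ _ _ _ _ hi, ← hY.map_succ i hi]
    refine le_antisymm ?_ (Submodule.le_comap_map _ _)
    rintro v ⟨y, hy, hyv⟩
    rw [← proj_add_smul l v₀ v, ← hyv, proj_apply]
    have hv₀ := hY.apex_mem i hi
    exact add_mem (sub_mem hy (Submodule.smul_mem _ _ hv₀)) (Submodule.smul_mem _ _ hv₀)

/-- The graph over `W j` recovers the functional on `W j`, and all smaller graphs use only its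
values there. -/
lemma liftFlag_eq_iff (h : IsConeBase E φ l v₀) {r : ℕ} {W : Fin (r + 1) → Submodule K V}
    (hW : IsSubspaceFlag E φ W) (j : Fin (r + 1)) (F G : V →ₗ[K] K) :
    liftFlag l v₀ W j F = liftFlag l v₀ W j G ↔ F.domRestrict (W j) = G.domRestrict (W j) := by
  have hker : ∀ i, ∀ w ∈ W i, l w = 0 := fun i w hw => h.le_ker (hW.span_eq i) hw
  constructor
  · intro hFG
    have h1 := congrFun hFG j.castSucc
    rw [liftFlag_castSucc _ _ _ _ le_rfl, liftFlag_castSucc _ _ _ _ le_rfl] at h1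
    ext ⟨w, hw⟩
    have h2 : shear F v₀ w ∈ (W j).map (shear G v₀) := h1 ▸ Submodule.mem_map_of_mem hw
    obtain ⟨w', hw', hww'⟩ := h2
    have h3 := congrArg (proj l v₀) hww'
    rw [h.proj_shear _ (hker j _ hw), h.proj_shear _ (hker j _ hw')] at h3
    rw [h3, shear_apply, shear_apply, add_right_inj] at hww'
    have h4 := congrArg l hww'
    rw [map_smul, map_smul, h.apex, smul_eq_mul, smul_eq_mul, mul_one, mul_one] at h4
    exact h4.symm
  · intro hFG
    have hs : ∀ i ≤ j, ∀ w ∈ W i, shear F v₀ w = shear G v₀ w := fun i hi w hw => by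
      rw [shear_apply, shear_apply]
      have : F w = G w := LinearMap.congr_fun hFG ⟨w, hW.monotone hi hw⟩
      rw [this]
    funext k
    rcases exists_castSucc_or_succ j k with ⟨i, hi, rfl⟩ | ⟨i, hi, rfl⟩
    · rw [liftFlag_castSucc _ _ _ _ hi, liftFlag_castSucc _ _ _ _ hi]
      ext v
      simp only [Submodule.mem_map]
      exact exists_congr fun w => and_congr_right fun hw => by rw [hs i hi w hw]
    · rw [liftFlag_succ _ _ _ _ hi, liftFlag_succ _ _ _ _ hi]

/-- A flag `W` of the base has `q ^ j` lifts that contain the apex from the index `j + 1` on. -/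
lemma card_isLift [Finite K] [FiniteDimensional K V] (h : IsConeBase E φ l v₀) {r : ℕ}
    {W : Fin (r + 1) → Submodule K V} (hW : IsSubspaceFlag E φ W) (j : Fin (r + 1)) :
    Nat.card {Y // IsLift E φ l v₀ W j Y} = Nat.card K ^ (j : ℕ) := by
  have hdual : Nat.card (Dual K (W j)) = Nat.card K ^ (j : ℕ) := by
    rw [Module.natCard_eq_pow_finrank (K := K), Subspace.dual_finrank_eq, hW.finrank_eq]
  rw [← hdual]
  -- Lifts correspond to functionals on `W j`. Since `liftFlag` takes a functional on `V`, each is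
  -- extended; by `liftFlag_eq_iff` the extension chosen is immaterial.
  choose ext hext using fun f : Dual K (W j) => LinearMap.exists_extend f
  refine (Nat.card_congr (Equiv.ofBijective
    (fun f : Dual K (W j) => (⟨liftFlag l v₀ W j (ext f), h.isLift_liftFlag hW j (ext f)⟩ :
      {Y // IsLift E φ l v₀ W j Y})) ⟨fun f g hfg => ?_, fun Y => ?_⟩)).symm
  · have h1 := (h.liftFlag_eq_iff hW j _ _).1 (congrArg Subtype.val hfg)
    exact (hext f).symm.trans (h1.trans (hext g))
  · obtain ⟨F, hF⟩ := exists_eq_liftFlag Y.2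
    exact ⟨F.domRestrict (W j), Subtype.ext (((h.liftFlag_eq_iff hW j _ _).2 (hext _)).trans hF)⟩

/-- The projections of the members of `Y` have dimensions `0, …, j, j, …, r`; dropping the
repetition leaves the flag `W`. -/
lemma exists_isLift [FiniteDimensional K V] (h : IsConeBase E φ l v₀) {r : ℕ}
    (hV : finrank K V = r + 1) {Y : Fin (r + 2) → Submodule K V}
    (hY : IsSubspaceFlag (conePoints E φ l v₀) Projectivization.rep Y) :
    ∃ W : Fin (r + 1) → Submodule K V, ∃ j, IsSubspaceFlag E φ W ∧ IsLift E φ l v₀ W j Y := by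
  have hlast : v₀ ∈ Y (Fin.last (r + 1)) := by
    have : Y (Fin.last (r + 1)) = ⊤ := by
      apply Submodule.eq_top_of_finrank_eq
      rw [hY.finrank_eq, hV, Fin.val_last]
    rw [this]; trivial
  obtain ⟨j, hj₁, hj₂⟩ : ∃ j : Fin (r + 1), v₀ ∉ Y j.castSucc ∧ v₀ ∈ Y j.succ := by
    by_contra! hcon
    have : ∀ k, v₀ ∉ Y k := by
      intro k
      induction k using Fin.induction with
      | zero =>
        have : Y 0 = ⊥ := Submodule.finrank_eq_zero.1 (by simpa using hY.finrank_eq 0)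
        rw [this]; exact h.apex_ne_zero
      | succ k ih => exact hcon k ih
    exact this _ hlast
  have hlow : ∀ i ≤ j, v₀ ∉ Y i.castSucc := fun i hi hv =>
    hj₁ (hY.monotone (Fin.castSucc_le_castSucc_iff.2 hi) hv)
  have hhigh : ∀ i, j ≤ i → v₀ ∈ Y i.succ := fun i hi =>
    hY.monotone (Fin.succ_le_succ_iff.2 hi) hj₂
  -- Both projections have dimension `j`: the step that adds the apex adds nothing to the
  -- projection.
  have hjj : (Y j.castSucc).map (proj l v₀) = (Y j.succ).map (proj l v₀) := by
    apply Submodule.eq_of_le_of_finrank_eq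
      (Submodule.map_mono (hY.monotone (Fin.castSucc_le_succ j)))
    have h1 := h.finrank_map_proj_of_mem hj₂
    rw [finrank_map_proj_of_notMem hj₁]
    rw [hY.finrank_eq] at h1 ⊢
    simp only [Fin.val_succ, Fin.val_castSucc] at h1 ⊢
    omega
  set W : Fin (r + 1) → Submodule K V := fun i =>
    (Y (if i ≤ j then i.castSucc else i.succ)).map (proj l v₀) with hWdef
  have hW₁ : ∀ i ≤ j, (Y i.castSucc).map (proj l v₀) = W i := fun i hi => by simp [hWdef, hi]
  have hW₂ : ∀ i, j ≤ i → (Y i.succ).map (proj l v₀) = W i := fun i hi => by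
    rcases hi.eq_or_lt with rfl | hlt
    · rw [← hW₁ _ le_rfl, hjj]
    · simp [hWdef, not_le.2 hlt]
  refine ⟨W, j, ⟨fun i i' hii' => Submodule.map_mono (hY.monotone ?_), fun i => ?_,
    fun i => span_map_proj (hY.span_eq _)⟩, hY, hlow, hW₁, hhigh, hW₂⟩
  · split_ifs with h1 h2 h2 <;>
      simp only [Fin.le_def, Fin.val_succ, Fin.val_castSucc] at * <;> omega
  · rcases le_total i j with hi | hi
    · rw [← hW₁ i hi, finrank_map_proj_of_notMem (hlow i hi), hY.finrank_eq, Fin.val_castSucc]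
    · rw [← hW₂ i hi]
      have h1 := h.finrank_map_proj_of_mem (hhigh i hi)
      rw [hY.finrank_eq, Fin.val_succ] at h1
      omega

/-- The index `j` is where the apex enters, and `W` is then read off by projecting. -/
lemma isLift_unique {r : ℕ} {W W' : Fin (r + 1) → Submodule K V} {j j' : Fin (r + 1)}
    {Y : Fin (r + 2) → Submodule K V} (hY : IsLift E φ l v₀ W j Y)
    (hY' : IsLift E φ l v₀ W' j' Y) : W = W' ∧ j = j' := by
  have hle : ∀ {W W' : Fin (r + 1) → Submodule K V} {j j' : Fin (r + 1)},
      IsLift E φ l v₀ W j Y → IsLift E φ l v₀ W' j' Y → j' ≤ j := by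
    intro W W' j j' h1 h2
    by_contra! hlt
    exact h2.apex_notMem _ le_rfl
      (h1.isSubspaceFlag.monotone (Fin.succ_le_castSucc_iff.2 hlt) (h1.apex_mem j le_rfl))
  obtain rfl := le_antisymm (hle hY' hY) (hle hY hY')
  refine ⟨funext fun i => ?_, rfl⟩
  rcases le_total i j with hi | hi
  · rw [← hY.map_castSucc i hi, hY'.map_castSucc i hi]
  · rw [← hY.map_succ i hi, hY'.map_succ i hi]

lemma ncard_isLift [Finite K] [FiniteDimensional K V] (h : IsConeBase E φ l v₀) {r : ℕ}
    {W : Fin (r + 1) → Submodule K V} (hW : IsSubspaceFlag E φ W) {j : Fin (r + 1)}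
    {Y : Fin (r + 2) → Submodule K V} (hY : IsLift E φ l v₀ W j Y) {a : Fin (r + 1) → ℕ}
    (ha : ∀ i, {x ∈ E | φ x ∈ W i}.ncard = partialSum a i) (b : Fin (r + 2) → ℕ) :
    (∀ k, {p ∈ conePoints E φ l v₀ | p.rep ∈ Y k}.ncard = partialSum b k) ↔
      coneComposition (Nat.card K) a j = b := by
  obtain ⟨F, rfl⟩ := exists_eq_liftFlag hY
  refine forall_eq_partialSum_coneComposition_iff Nat.card_pos a j b
    (fun k => {p ∈ conePoints E φ l v₀ | p.rep ∈ liftFlag l v₀ W j F k}.ncard)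
    (fun i hi => ?_) (fun i hi => ?_)
  · simp only [liftFlag_castSucc _ _ _ _ hi]
    rw [h.ncard_map_shear F (fun w hw => h.le_ker (hW.span_eq i) hw), ha]
  · simp only [liftFlag_succ _ _ _ _ hi]
    rw [h.ncard_comap_proj, ha]

end IsConeBase

/-- Entries after the first are positive because consecutive subspaces are spanned by the elements
they contain and differ in dimension. -/
lemma IsSubspaceFlag.flagComposition_mem [FiniteDimensional K V] {E : Set α} {φ : α → V} {n r : ℕ}
    {W : Fin (r + 1) → Submodule K V} (hW : IsSubspaceFlag E φ W) (hE : E.encard = n)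
    (hr : finrank K (Submodule.span K (φ '' E)) = r) :
    flagComposition (fun i => {x ∈ E | φ x ∈ W i}) ∈ compositions n r := by
  have hfin : E.Finite := Set.finite_of_encard_eq_coe hE
  set X : Fin (r + 1) → Set α := fun i => {x ∈ E | φ x ∈ W i} with hX
  have hsub : ∀ i, X i ⊆ E := fun i => Set.sep_subset _ _
  have hmono : Monotone X := fun i j hij x hx => ⟨hx.1, hW.monotone hij hx.2⟩
  have hlast : X (Fin.last r) = E := by
    refine (hsub _).antisymm fun x hx => ⟨hx, ?_⟩
    have : W (Fin.last r) = Submodule.span K (φ '' E) := by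
      refine Submodule.eq_of_le_of_finrank_eq ?_ (by rw [hW.finrank_eq, hr, Fin.val_last])
      rw [← hW.span_eq]
      exact Submodule.span_mono (Set.image_mono (hsub _))
    rw [this]
    exact Submodule.subset_span ⟨x, hx, rfl⟩
  refine mem_compositions.2 ⟨?_, fun k hk => ?_⟩
  · rw [← partialSum_last, partialSum_flagComposition hmono (fun i => hfin.subset (hsub i)), hlast,
      Set.ncard, hE, ENat.toNat_natCast]
  · obtain ⟨i, rfl⟩ := Fin.exists_succ_eq.2 hk
    rw [flagComposition, Fin.cons_succ, Set.ncard_pos ((hfin.subset (hsub _)).sdiff),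
      Set.nonempty_iff_ne_empty, Ne, Set.sdiff_eq_empty]
    intro hle
    have h1 : W i.succ ≤ W i.castSucc := by
      rw [← hW.span_eq, ← hW.span_eq i.castSucc]
      exact Submodule.span_mono (Set.image_mono hle)
    have h2 := Submodule.finrank_mono h1
    rw [hW.finrank_eq, hW.finrank_eq, Fin.val_succ, Fin.val_castSucc] at h2
    omega

/-- The number of flags of a cone with a given composition. -/
lemma IsConeBase.ncard_flags [Finite K] [FiniteDimensional K V] {E : Set α} {φ : α → V}
    {l : V →ₗ[K] K} {v₀ : V} (h : IsConeBase E φ l v₀) {n r : ℕ} (hV : finrank K V = r + 1)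
    (hE : E.encard = n) (hr : finrank K (Submodule.span K (φ '' E)) = r)
    (b : Fin (r + 2) → ℕ) :
    {Y : Fin (r + 2) → Submodule K V |
      IsSubspaceFlag (conePoints E φ l v₀) Projectivization.rep Y ∧
      ∀ k, {p ∈ conePoints E φ l v₀ | p.rep ∈ Y k}.ncard = partialSum b k}.ncard =
    ∑ a : NRComposition n r, ∑ j : Fin (r + 1),
      if coneComposition (Nat.card K) a.1 j = b then Nat.card K ^ (j : ℕ) *
        {W : Fin (r + 1) → Submodule K V | IsSubspaceFlag E φ W ∧
          ∀ i, {x ∈ E | φ x ∈ W i}.ncard = partialSum a.1 i}.ncard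
      else 0 := by
  have hVfin : Finite V := Module.finite_of_finite K
  have hSfin : Finite (Submodule K V) := Finite.of_injective _ SetLike.coe_injective
  have hfin : E.Finite := Set.finite_of_encard_eq_coe hE
  set B : NRComposition n r → Set (Fin (r + 1) → Submodule K V) := fun a =>
    {W | IsSubspaceFlag E φ W ∧ ∀ i, {x ∈ E | φ x ∈ W i}.ncard = partialSum a.1 i} with hB
  set T := {Y : Fin (r + 2) → Submodule K V |
      IsSubspaceFlag (conePoints E φ l v₀) Projectivization.rep Y ∧
      ∀ k, {p ∈ conePoints E φ l v₀ | p.rep ∈ Y k}.ncard = partialSum b k} with hT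
  -- Every flag of the cone is sorted by the composition of its base flag, the index `j` and the
  -- base flag itself. The condition on `b` sits in the innermost fibre, which is empty when it
  -- fails, giving the zero summands.
  have e : (Σ a : NRComposition n r, Σ j : Fin (r + 1), Σ W : B a,
      {Y // IsLift E φ l v₀ W.1 j Y ∧ coneComposition (Nat.card K) a.1 j = b}) ≃ T := by
    refine Equiv.ofBijective (fun s => ⟨s.2.2.2.1, s.2.2.2.2.1.isSubspaceFlag,
      (h.ncard_isLift s.2.2.1.2.1 s.2.2.2.2.1 s.2.2.1.2.2 b).2 s.2.2.2.2.2⟩) ⟨?_, ?_⟩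
    · rintro ⟨a, j, ⟨W, hW, hWa⟩, Y, hY, hYb⟩ ⟨a', j', ⟨W', hW', hWa'⟩, Y', hY', hYb'⟩ hYY
      obtain rfl : Y = Y' := congrArg Subtype.val hYY
      obtain ⟨rfl, rfl⟩ := IsConeBase.isLift_unique hY hY'
      obtain rfl : a = a' := Subtype.ext (partialSum_injective
        (funext fun i => (hWa i).symm.trans (hWa' i)))
      rfl
    · rintro ⟨Y, hY, hYb⟩
      obtain ⟨W, j, hW, hWY⟩ := h.exists_isLift hV hY
      have hmono : Monotone (fun i => {x ∈ E | φ x ∈ W i}) :=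
        fun i i' hii' x hx => ⟨hx.1, hW.monotone hii' hx.2⟩
      have ha : ∀ i, {x ∈ E | φ x ∈ W i}.ncard =
          partialSum (flagComposition fun i => {x ∈ E | φ x ∈ W i}) i := fun i =>
        (partialSum_flagComposition hmono (fun i => hfin.subset (Set.sep_subset _ _)) i).symm
      exact ⟨⟨⟨_, hW.flagComposition_mem hE hr⟩, j, ⟨W, hW, ha⟩, Y, hWY,
        (h.ncard_isLift hW hWY ha b).1 hYb⟩, rfl⟩
  rw [← Nat.card_coe_set_eq, ← Nat.card_congr e, Nat.card_sigma]
  refine Finset.sum_congr rfl fun a _ => ?_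
  rw [Nat.card_sigma]
  refine Finset.sum_congr rfl fun j _ => ?_
  have := Fintype.ofFinite (B a)
  rw [Nat.card_sigma]
  split_ifs with hb
  · simp only [hb, and_true]
    rw [Finset.sum_congr rfl fun W _ => h.card_isLift W.2.1 j, Finset.sum_const, Finset.card_univ,
      ← Nat.card_eq_fintype_card, Nat.card_coe_set_eq, smul_eq_mul, mul_comm]
  · simp [hb]

end QConeCatenary

namespace QConeCatenary

open Module

/-! ### `q`-cones -/

variable {K V α : Type*} [Field K] [AddCommGroup V] [Module K V]

lemma represents_restrict (E : Set (ℙ K V)) :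
    Represents ((projectiveGeometry K V).restrict E) Projectivization.rep K := by
  intro I hI
  rw [Matroid.restrict_indep_iff, and_iff_left (by simpa using hI)]
  rfl

lemma represents_projectiveGeometry :
    Represents (projectiveGeometry K V) Projectivization.rep K := fun _ _ => Iff.rfl

lemma projectiveGeometry_ground : (projectiveGeometry K V).E = Set.univ := rfl

lemma IsIsomorphic.exists_represents {M : Matroid α} {E : Set (ℙ K V)}
    (h : IsIsomorphic ((projectiveGeometry K V).restrict E) M) (p₀ : ℙ K V) :
    ∃ ψ : α → ℙ K V, ψ '' M.E = E ∧ Set.InjOn ψ M.E ∧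
      Represents M (fun x => (ψ x).rep) K := by
  classical
  obtain ⟨e, he⟩ := h
  -- The value `p₀` outside the ground set is a dummy.
  set ψ : α → ℙ K V := fun x => if hx : x ∈ M.E then (e.symm ⟨x, hx⟩ : ℙ K V) else p₀ with hψ
  have hψx : ∀ (x) (hx : x ∈ M.E), ψ x = e.symm ⟨x, hx⟩ := fun x hx => by simp [hψ, hx]
  have hψe : ∀ p, ψ (e p) = p := fun p => by
    rw [hψx _ (e p).2, Subtype.coe_eta, Equiv.symm_apply_apply]
  have hinj : Set.InjOn ψ M.E := fun x hx y hy hxy => by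
    rw [hψx x hx, hψx y hy] at hxy
    exact congrArg Subtype.val (e.symm.injective (Subtype.ext hxy))
  refine ⟨ψ, ?_, hinj, fun I hI => ?_⟩
  · ext p
    constructor
    · rintro ⟨x, hx, rfl⟩
      rw [hψx x hx]
      exact (e.symm ⟨x, hx⟩).2
    · exact fun hp => ⟨e ⟨p, hp⟩, (e ⟨p, hp⟩).2, hψe ⟨p, hp⟩⟩
  · have h1 := he (e ⁻¹' (Subtype.val ⁻¹' I))
    rw [Set.image_preimage_eq _ e.surjective, Subtype.image_preimage_coe,
      Set.inter_eq_right.2 hI] at h1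
    have h2 : Subtype.val '' (e ⁻¹' (Subtype.val ⁻¹' I)) = ψ '' I := by
      ext p
      constructor
      · rintro ⟨p, hp, rfl⟩; exact ⟨e p, hp, hψe p⟩
      · rintro ⟨x, hx, rfl⟩
        exact ⟨e.symm ⟨x, hI hx⟩, by rw [Set.mem_preimage, Equiv.apply_symm_apply]; exact hx, (hψx x (hI hx)).symm⟩
    rw [h2] at h1
    rw [← h1, represents_restrict E]
    · exact ⟨fun hl => LinearIndepOn.comp_of_image (f := ψ) (v := Projectivization.rep) hl (hinj.mono hI),
        fun hl => LinearIndepOn.image_of_comp ψ _ hl⟩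
    · rw [← h2]; rintro _ ⟨p, -, rfl⟩; exact p.2

/-- The numbers of elements and the rank, and the catenary data of a `q`-cone. -/
theorem IsQCone.catenaryData_eq [Finite K] {M : Matroid α} {M' : Matroid (ℙ K V)} {q n r : ℕ}
    (hn : 0 < n) (hq : Nat.card K = q) (hE : M.E.encard = n) (hr : M.eRank = r)
    (h : IsQCone M M') :
    M'.E.encard = (q * n + 1 : ℕ) ∧ M'.eRank = (r + 1 : ℕ) ∧
      catenaryData (q * n + 1) (r + 1) M' = coneCatenaryData q (catenaryData n r M) := by
  obtain ⟨hV, E, a, hiso, ha, rfl⟩ := h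
  have hV' : finrank K V = r + 1 := by rw [hr] at hV; exact_mod_cast hV
  have hfd : FiniteDimensional K V := FiniteDimensional.of_finrank_pos (by omega)
  have hVfin : Finite V := Module.finite_of_finite K
  have hfin : M.E.Finite := Set.finite_of_encard_eq_coe hE
  obtain ⟨ψ, rfl, hinj, hrep⟩ := hiso.exists_represents a
  set φ : α → V := fun x => (ψ x).rep with hφ
  have ha' : a.rep ∉ Submodule.span K (φ '' M.E) := by
    rw [represents_projectiveGeometry.closure_eq (Set.subset_univ _)] at ha
    rw [Set.image_image] at ha
    exact fun hmem => ha ⟨trivial, hmem⟩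
  -- A functional that vanishes on the span of the base but not at the apex; dividing by its value
  -- there gives `l`.
  obtain ⟨f, hfa, hf⟩ := Submodule.exists_le_ker_of_notMem ha'
  have hbase : IsConeBase M.E φ ((f a.rep)⁻¹ • f) a.rep := by
    refine ⟨by simp [hfa], fun x hx => ?_, fun x _ => (ψ x).rep_nonzero,
      fun x hx y hy c hc => ?_, ?_⟩
    · have : f (φ x) = 0 := hf (Submodule.subset_span ⟨x, hx, rfl⟩)
      simp [this]
    · refine (hinj hy hx ?_).symm
      rw [← (ψ x).mk_rep, ← (ψ y).mk_rep]
      exact (Projectivization.mk_eq_mk_iff' K _ _ _ _).2 ⟨c, hc⟩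
    · rw [← Set.encard_ne_zero, hE]; exact_mod_cast hn.ne'
  set l := (f a.rep)⁻¹ • f with hl
  have hS : (⋃ p ∈ ψ '' M.E, (projectiveGeometry K V).closure {a, p}) =
      conePoints M.E φ l a.rep := by
    ext p
    simp only [Set.biUnion_image, Set.mem_iUnion, exists_prop, conePoints, Set.mem_ofPred_eq]
    refine exists_congr fun x => and_congr_right fun hx => ?_
    rw [represents_projectiveGeometry.closure_eq (Set.subset_univ _), Set.image_pair]
    simp only [Set.mem_ofPred_eq, projectiveGeometry_ground, Set.mem_univ, true_and]
    rw [Submodule.mem_span_pair, Submodule.mem_span_singleton]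
    constructor
    · rintro ⟨c, d, hcd⟩
      refine ⟨d, ?_⟩
      rw [← hcd, map_add, map_smul, map_smul, hbase.proj_apex, smul_zero, zero_add,
        IsConeBase.proj_of_eq_zero (hbase.base x hx)]
    · rintro ⟨d, hd⟩
      exact ⟨l p.rep, d, by rw [add_comm]; change d • φ x + _ = _; rw [hd, proj_add_smul]⟩
  rw [hS]
  have hspan : finrank K (Submodule.span K (φ '' M.E)) = r := by
    rw [← M.eRk_ground, hrep.eRk_eq subset_rfl] at hr
    exact_mod_cast hr
  set W := Submodule.span K (φ '' M.E) with hWdef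
  have hWE : {x ∈ M.E | φ x ∈ W} = M.E :=
    Set.sep_eq_self_iff_mem_true.2 fun x hx => Submodule.subset_span ⟨x, hx, rfl⟩
  have hW : Submodule.span K (φ '' {x ∈ M.E | φ x ∈ W}) = W := by rw [hWE]
  -- The preimage of the span of the base is everything, so the size and the rank of the whole cone
  -- are instances of the general results on preimages.
  have htop : W.comap (proj l a.rep) = ⊤ := by
    apply Submodule.eq_top_of_finrank_eq
    rw [← hbase.finrank_map_proj_of_mem (hbase.apex_mem_comap_proj W),
      IsConeBase.map_proj_comap_proj (fun w hw => hbase.le_ker hW hw), hspan, hV']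
  have hcard : (conePoints M.E φ l a.rep).encard = (q * n + 1 : ℕ) := by
    have h1 := hbase.ncard_comap_proj (W := W)
    rw [htop, hWE, hq, Set.ncard, Set.ncard, hE] at h1
    simp only [Submodule.mem_top, and_true, Set.ofPred_mem_eq, ENat.toNat_natCast] at h1
    rw [← h1, ENat.natCast_toNat]
    exact (Set.toFinite _).encard_lt_top.ne
  have hrank : ((projectiveGeometry K V).restrict (conePoints M.E φ l a.rep)).eRank =
      (r + 1 : ℕ) := by
    rw [← Matroid.eRk_ground, (represents_restrict _).eRk_eq subset_rfl]
    have h1 := hbase.span_comap_proj hW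
    rw [htop] at h1
    simp only [Submodule.mem_top, and_true, Set.ofPred_mem_eq] at h1
    rw [Matroid.restrict_ground_eq, h1, finrank_top, hV']
  refine ⟨hcard, hrank, funext fun b => ?_⟩
  rw [(represents_restrict _).catenaryData_eq (Set.toFinite _) hrank]
  refine (hbase.ncard_flags hV' hE hspan b.1).trans ?_
  simp only [hrep.catenaryData_eq hfin hr, coneCatenaryData, hq]

end QConeCatenary

namespace QConeCatenary

/-! ### Sequences of zeros and ones -/

/-- The sum of the first `m` terms of `s`. -/
def prefixSum {n : ℕ} (s : Fin n → ℕ) (m : ℕ) : ℕ :=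
  ∑ k ∈ Finset.univ.filter (fun k : Fin n => (k : ℕ) < m), s k

lemma prefixSum_zero {n : ℕ} (s : Fin n → ℕ) : prefixSum s 0 = 0 := by simp [prefixSum]

lemma prefixSum_succ {n : ℕ} (s : Fin n → ℕ) (j : Fin n) :
    prefixSum s (j + 1) = prefixSum s j + s j := by
  have : (Finset.univ.filter fun k : Fin n => (k : ℕ) < j + 1) =
      insert j (Finset.univ.filter fun k : Fin n => (k : ℕ) < j) := by
    ext k
    simp only [Finset.mem_filter, Finset.mem_univ, true_and, Finset.mem_insert, Fin.ext_iff]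
    omega
  rw [prefixSum, this, Finset.sum_insert (by simp), add_comm, prefixSum]

lemma prefixSum_self {n : ℕ} (s : Fin n → ℕ) : prefixSum s n = ∑ k, s k := by
  simp [prefixSum]

lemma prefixSum_mono {n : ℕ} (s : Fin n → ℕ) : Monotone (prefixSum s) := fun m m' h =>
  Finset.sum_le_sum_of_subset fun k hk => by
    simp only [Finset.mem_filter, Finset.mem_univ, true_and] at hk ⊢
    omega

lemma prefixSum_le {n r : ℕ} (s : NRSequence n r) (m : ℕ) : prefixSum s.1 m ≤ r :=
  (Finset.sum_le_sum_of_subset (Finset.filter_subset _ _)).trans s.2.2.le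

/-- The largest `m ≤ n` such that the first `m` terms of `s` have sum at most `i`. -/
def lastPrefix {n : ℕ} (s : Fin n → ℕ) (i : ℕ) : ℕ :=
  Nat.findGreatest (fun m => prefixSum s m ≤ i) n

lemma lastPrefix_le {n : ℕ} (s : Fin n → ℕ) (i : ℕ) : lastPrefix s i ≤ n := Nat.findGreatest_le n

lemma le_lastPrefix {n : ℕ} (s : Fin n → ℕ) {m i : ℕ} (hm : m ≤ n) (h : prefixSum s m ≤ i) :
    m ≤ lastPrefix s i := Nat.le_findGreatest hm h

/-- Prefix sums grow by at most one at a time, so they skip no value up to `r`. -/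
lemma prefixSum_lastPrefix {n r : ℕ} (s : NRSequence n r) {i : ℕ} (hi : i ≤ r) :
    prefixSum s.1 (lastPrefix s.1 i) = i := by
  have h0 : prefixSum s.1 0 ≤ i := by rw [prefixSum_zero]; exact Nat.zero_le _
  have hle : prefixSum s.1 (lastPrefix s.1 i) ≤ i :=
    Nat.findGreatest_spec (P := fun m => prefixSum s.1 m ≤ i) (Nat.zero_le n) h0
  refine le_antisymm hle ?_
  rcases (lastPrefix_le s.1 i).eq_or_lt with heq | hlt
  · rw [heq, prefixSum_self, s.2.2]; exact hi
  · have h1 : ¬ prefixSum s.1 (lastPrefix s.1 i + 1) ≤ i :=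
      Nat.findGreatest_is_greatest (P := fun m => prefixSum s.1 m ≤ i) (Nat.lt_succ_self _) hlt
    have h2 := prefixSum_succ s.1 ⟨_, hlt⟩
    simp only at h2
    rcases s.2.1 ⟨_, hlt⟩ with h3 | h3 <;> omega

lemma lastPrefix_mono {n : ℕ} (s : Fin n → ℕ) : Monotone (lastPrefix s) := fun i j hij =>
  le_lastPrefix s (lastPrefix_le s i) (le_trans
    (Nat.findGreatest_spec (P := fun m => prefixSum s m ≤ i) (Nat.zero_le n)
      (by rw [prefixSum_zero]; exact Nat.zero_le _)) hij)

/-! ### Rank sequences and flags -/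

variable {α : Type*} {n r : ℕ}

/-- The first `m` elements of an ordering. -/
def initialSet {N : Matroid α} (π : Fin n ≃ N.E) (m : ℕ) : Set α :=
  (fun i => (π i : α)) '' {i | (i : ℕ) < m}

lemma initialSet_subset {N : Matroid α} (π : Fin n ≃ N.E) (m : ℕ) : initialSet π m ⊆ N.E := by
  rintro _ ⟨i, -, rfl⟩; exact (π i).2

lemma initialSet_mono {N : Matroid α} (π : Fin n ≃ N.E) : Monotone (initialSet π) :=
  fun _ _ h => Set.image_mono fun _ hi => lt_of_lt_of_le hi h

lemma initialSet_zero {N : Matroid α} (π : Fin n ≃ N.E) : initialSet π 0 = ∅ := by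
  simp [initialSet]

lemma initialSet_self {N : Matroid α} (π : Fin n ≃ N.E) : initialSet π n = N.E := by
  refine (initialSet_subset π n).antisymm fun e he => ⟨π.symm ⟨e, he⟩, Fin.is_lt _, ?_⟩
  simp

lemma initialSet_succ {N : Matroid α} (π : Fin n ≃ N.E) (j : Fin n) :
    initialSet π (j + 1) = insert (π j : α) (initialSet π j) := by
  have : {i : Fin n | (i : ℕ) < j + 1} = insert j {i : Fin n | (i : ℕ) < j} := by
    ext i
    simp only [Set.mem_ofPred_eq, Set.mem_insert_iff, Fin.ext_iff]
    omega
  rw [initialSet, this, Set.image_insert_eq, initialSet]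

lemma rankSequence_apply {N : Matroid α} (π : Fin n ≃ N.E) (j : Fin n) :
    rankSequence N π j =
      (N.eRk (initialSet π (j + 1))).toNat - (N.eRk (initialSet π j)).toNat := by
  have h1 : Set.Iic j = {i : Fin n | (i : ℕ) < j + 1} := by
    ext i; simp only [Set.mem_Iic, Set.mem_ofPred_eq, Fin.le_def]; omega
  have h2 : Set.Iio j = {i : Fin n | (i : ℕ) < j} := rfl
  rw [rankSequence, h1, h2]
  rfl

lemma eRk_initialSet_ne_top {N : Matroid α} (hr : N.eRank = r) (S : Set α) : N.eRk S ≠ ⊤ :=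
  ((N.eRk_le_eRank S).trans_lt (hr ▸ ENat.natCast_lt_top r)).ne

/-- An ordering has rank sequence `s` if and only if the ranks of its initial sets are the sums of
the initial terms of `s`. -/
lemma rankSequence_eq_iff {N : Matroid α} (hr : N.eRank = r) (π : Fin n ≃ N.E) (s : Fin n → ℕ) :
    rankSequence N π = s ↔ ∀ m ≤ n, N.eRk (initialSet π m) = prefixSum s m := by
  constructor
  · rintro rfl m hm
    induction m with
    | zero => rw [initialSet_zero, N.eRk_empty, prefixSum_zero, Nat.cast_zero]
    | succ m ih =>
      have h1 := prefixSum_succ (rankSequence N π) ⟨m, hm⟩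
      simp only at h1
      have h2 := rankSequence_apply π ⟨m, hm⟩
      simp only at h2
      have h3 : (N.eRk (initialSet π m)).toNat ≤ (N.eRk (initialSet π (m + 1))).toNat :=
        ENat.toNat_le_toNat (N.eRk_mono (initialSet_mono π (Nat.le_succ m)))
          (eRk_initialSet_ne_top hr _)
      have h4 : (N.eRk (initialSet π m)).toNat = prefixSum (rankSequence N π) m := by
        rw [ih (by omega), ENat.toNat_natCast]
      rw [← ENat.natCast_toNat (eRk_initialSet_ne_top hr (initialSet π (m + 1)))]
      congr 1
      omega
  · intro h
    funext j
    rw [rankSequence_apply, h _ j.2, h _ j.2.le, ENat.toNat_natCast, ENat.toNat_natCast,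
      prefixSum_succ]
    omega

/-- The ordering `π` is compatible with the level function `ℓ` and the sequence `s`: an element at a
place where `s` is `1` has the level of its initial set, all the others have at most this level. -/
def Compatible {T : Type*} (s : Fin n → ℕ) (ℓ : T → Fin (r + 1)) (π : Fin n ≃ T) : Prop :=
  ∀ j, (ℓ (π j) : ℕ) ≤ prefixSum s (j + 1) ∧ (s j = 1 → prefixSum s j < ℓ (π j))

lemma IsFlag.exists_level {N : Matroid α} {X : Fin (r + 1) → Set α} (hX : IsFlag N X) :
    ∃ ℓ : N.E → Fin (r + 1), ∀ (e : N.E) i, (e : α) ∈ X i ↔ ℓ e ≤ i := by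
  classical
  have hmin : ∀ e : N.E, ∃ k, (e : α) ∈ X k ∧ ∀ i, (e : α) ∈ X i → k ≤ i := fun e => by
    have hne : (Finset.univ.filter fun i => (e : α) ∈ X i).Nonempty :=
      ⟨Fin.last r, by simp [hX.last_eq]⟩
    obtain ⟨k, hk, hmin⟩ := Finset.exists_min_image _ id hne
    exact ⟨k, (Finset.mem_filter.1 hk).2, fun i hi => hmin i (by simp [hi])⟩
  choose ℓ h1 h2 using hmin
  exact ⟨ℓ, fun e i => ⟨h2 e i, fun hi => hX.strictMono.monotone hi (h1 e)⟩⟩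

section

variable {N : Matroid α} {X : Fin (r + 1) → Set α} {ℓ : N.E → Fin (r + 1)} {s : NRSequence n r}
  {π : Fin n ≃ N.E}

lemma Compatible.initialSet_subset (hℓ : ∀ (e : N.E) i, (e : α) ∈ X i ↔ ℓ e ≤ i)
    (h : Compatible s.1 ℓ π) {m : ℕ} {i : Fin (r + 1)} (hi : (i : ℕ) = prefixSum s.1 m) :
    initialSet π m ⊆ X i := by
  rintro _ ⟨j, hj, rfl⟩
  rw [hℓ, Fin.le_def, hi]
  exact (h j).1.trans (prefixSum_mono _ hj)

/-- The flats of the flag bound the ranks from above. At each term 1 the new element lies outside a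
flat containing the preceding elements, so the rank does grow. -/
lemma Compatible.eRk_initialSet (hX : IsFlag N X) (hℓ : ∀ (e : N.E) i, (e : α) ∈ X i ↔ ℓ e ≤ i)
    (h : Compatible s.1 ℓ π) {m : ℕ} (hm : m ≤ n) :
    N.eRk (initialSet π m) = prefixSum s.1 m := by
  have hle : ∀ m, N.eRk (initialSet π m) ≤ prefixSum s.1 m := fun m => by
    have := hX.eRk_eq ⟨prefixSum s.1 m, Nat.lt_succ_of_le (prefixSum_le s m)⟩
    simp only at this
    rw [← this]
    exact N.eRk_mono (h.initialSet_subset hℓ rfl)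
  induction m with
  | zero => rw [initialSet_zero, N.eRk_empty, prefixSum_zero, Nat.cast_zero]
  | succ m ih =>
    have ih := ih (by omega)
    have h1 := prefixSum_succ s.1 ⟨m, hm⟩
    simp only at h1
    rcases s.2.1 ⟨m, hm⟩ with h0 | h0
    · refine (hle _).antisymm ?_
      rw [h1, h0, add_zero, ← ih]
      exact N.eRk_mono (initialSet_mono π (Nat.le_succ m))
    · have h2 := initialSet_succ π ⟨m, hm⟩
      simp only at h2
      set i : Fin (r + 1) := ⟨prefixSum s.1 m, Nat.lt_succ_of_le (prefixSum_le s m)⟩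
      have h3 : N.closure (initialSet π m) ⊆ X i := by
        rw [← (hX.isFlat i).closure]
        exact N.closure_subset_closure (h.initialSet_subset hℓ rfl)
      rw [h2, Matroid.eRk_insert_eq_add_one, ih, h1, h0, Nat.cast_add, Nat.cast_one]
      refine ⟨(π ⟨m, hm⟩).2, fun hmem => ?_⟩
      have h4 := (hℓ _ _).1 (h3 hmem)
      exact absurd h4 (not_le.2 ((h ⟨m, hm⟩).2 h0))

/-- The initial set lies in `X i` and has the same rank, hence spans it. So an ordering is
compatible with at most one flag. -/
lemma Compatible.closure_initialSet (hr : N.eRank = r) (hX : IsFlag N X)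
    (hℓ : ∀ (e : N.E) i, (e : α) ∈ X i ↔ ℓ e ≤ i) (h : Compatible s.1 ℓ π) (i : Fin (r + 1)) :
    X i = N.closure (initialSet π (lastPrefix s.1 i)) := by
  have hi := prefixSum_lastPrefix s (Nat.le_of_lt_succ i.2)
  rw [← (hX.isFlat i).closure]
  symm
  refine Matroid.IsRkFinite.closure_eq_closure_of_subset_of_eRk_ge_eRk
    (Matroid.eRk_ne_top_iff.1 (eRk_initialSet_ne_top hr _))
    (h.initialSet_subset hℓ hi.symm) ?_
  rw [hX.eRk_eq, h.eRk_initialSet hX hℓ (lastPrefix_le _ _), hi]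

/-- The chain of closures of initial sets of an ordering is a flag. -/
lemma isFlag_closure_initialSet (hr : N.eRank = r)
    (hπ : ∀ m ≤ n, N.eRk (initialSet π m) = prefixSum s.1 m) :
    IsFlag N (fun i : Fin (r + 1) => N.closure (initialSet π (lastPrefix s.1 i))) := by
  have hrk : ∀ i : Fin (r + 1),
      N.eRk (N.closure (initialSet π (lastPrefix s.1 i))) = (i : ℕ) := fun i => by
    rw [N.eRk_closure_eq, hπ _ (lastPrefix_le _ _),
      prefixSum_lastPrefix s (Nat.le_of_lt_succ i.2)]
  refine ⟨?_, fun i => N.isFlat_closure _, hrk, ?_, ?_⟩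
  · refine Monotone.strictMono_of_injective (fun i j hij => ?_) fun i j hij => ?_
    · exact N.closure_subset_closure (initialSet_mono π (lastPrefix_mono _ hij))
    · have h1 := hrk i
      rw [show N.closure _ = N.closure _ from hij, hrk j] at h1
      exact Fin.ext (by exact_mod_cast h1.symm)
  · symm
    refine Matroid.IsRkFinite.closure_eq_closure_of_subset_of_eRk_ge_eRk
      (Matroid.eRk_ne_top_iff.1 (eRk_initialSet_ne_top hr _)) (Set.empty_subset _) ?_
    have := hrk 0
    rw [N.eRk_closure_eq] at this
    simp only [Fin.val_zero] at this ⊢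
    simp [this]
  · have : lastPrefix s.1 r = n := (lastPrefix_le _ _).antisymm
      (le_lastPrefix _ le_rfl (prefixSum_le s n))
    simp only [Fin.val_last, this, initialSet_self, Matroid.closure_ground]

lemma compatible_of_eRk_initialSet
    (hℓ : ∀ (e : N.E) (i : Fin (r + 1)),
      (e : α) ∈ N.closure (initialSet π (lastPrefix s.1 i)) ↔ ℓ e ≤ i)
    (hπ : ∀ m ≤ n, N.eRk (initialSet π m) = prefixSum s.1 m) : Compatible s.1 ℓ π := by
  refine fun j => ⟨?_, fun hj => ?_⟩
  · refine (hℓ (π j) ⟨prefixSum s.1 (j + 1), Nat.lt_succ_of_le (prefixSum_le s _)⟩).1 ?_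
    refine N.subset_closure _ (initialSet_subset π _) (initialSet_mono π
      (le_lastPrefix s.1 j.2 le_rfl) ⟨j, Nat.lt_succ_self _, rfl⟩)
  · by_contra! hle
    have h1 := (hℓ (π j) ⟨prefixSum s.1 j, Nat.lt_succ_of_le (prefixSum_le s _)⟩).2 hle
    simp only at h1
    have h2 := prefixSum_succ s.1 j
    -- Because `s j = 1`, the prefix of length `j + 1` already has a larger sum.
    have h3 : lastPrefix s.1 (prefixSum s.1 j) ≤ j := by
      by_contra! hlt
      have h4 := prefixSum_mono s.1 (Nat.succ_le_of_lt hlt)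
      rw [prefixSum_lastPrefix s (prefixSum_le s _), Nat.succ_eq_add_one, h2] at h4
      omega
    have h4 : initialSet π (j + 1) ⊆ N.closure (initialSet π j) := by
      rw [initialSet_succ]
      exact Set.insert_subset (N.closure_subset_closure (initialSet_mono π h3) h1)
        (N.subset_closure _ (initialSet_subset π _))
    have h5 := N.eRk_mono h4
    rw [N.eRk_closure_eq, hπ _ j.2, hπ _ j.2.le, h2] at h5
    have h6 : prefixSum s.1 j + s.1 j ≤ prefixSum s.1 j := by exact_mod_cast h5
    omega

end

/-! ### The `𝒢`-invariant in terms of the catenary data -/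

/-- The number of orderings with rank sequence `s` that have a given flag of composition `a`. -/
noncomputable def compatibleCount (s : Fin n → ℕ) (a : Fin (r + 1) → ℕ) : ℕ :=
  Nat.card {π : Fin n ≃ (Σ i, Fin (a i)) // Compatible s Sigma.fst π}

/-- Level sizes determine a levelled set up to relabelling; hence the number of compatible orderings
depends only on the composition. -/
lemma exists_equiv_sigma {T : Type*} [Finite T] (ℓ : T → Fin (r + 1)) (a : Fin (r + 1) → ℕ)
    (h : ∀ i, {t | ℓ t ≤ i}.ncard = partialSum a i) :
    ∃ e : T ≃ (Σ i, Fin (a i)), ∀ t, (e t).1 = ℓ t := by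
  have hcomp : flagComposition (fun i => {t | ℓ t ≤ i}) = a :=
    (flagComposition_eq_iff (X := fun i => {t | ℓ t ≤ i})
      (fun i j hij t (ht : ℓ t ≤ i) => ht.trans hij) (fun i => Set.toFinite _) a).2 h
  have hcard : ∀ i, Nat.card {t // ℓ t = i} = a i := fun i => by
    rw [← congrFun hcomp i]
    change Set.ncard {t | ℓ t = i} = _
    induction i using Fin.cases with
    | zero => simp [flagComposition]
    | succ i =>
      rw [flagComposition, Fin.cons_succ]
      congr 1
      ext t
      simp only [Set.mem_ofPred_eq, Set.mem_sdiff, Fin.ext_iff, Fin.le_def, Fin.val_succ,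
        Fin.val_castSucc]
      omega
  refine ⟨(Equiv.sigmaFiberEquiv ℓ).symm.trans (Equiv.sigmaCongrRight fun i =>
    Finite.equivFinOfCardEq (hcard i)), fun t => rfl⟩

lemma card_compatible {T : Type*} [Finite T] (s : Fin n → ℕ) (ℓ : T → Fin (r + 1))
    (a : Fin (r + 1) → ℕ) (h : ∀ i, {t | ℓ t ≤ i}.ncard = partialSum a i) :
    Nat.card {π : Fin n ≃ T // Compatible s ℓ π} = compatibleCount s a := by
  obtain ⟨e, he⟩ := exists_equiv_sigma ℓ a h
  refine Nat.card_congr (Equiv.subtypeEquiv ((Equiv.refl _).equivCongr e) fun π => ?_)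
  simp only [Compatible, Equiv.equivCongr_apply_apply, Equiv.refl_symm, Equiv.refl_apply, he]

/-- The number of orderings with a given rank sequence is a linear function of the catenary
data. -/
theorem card_rankSequence_eq {N : Matroid α} (hE : N.E.encard = n) (hr : N.eRank = r)
    (s : NRSequence n r) :
    Nat.card {π : Fin n ≃ N.E // rankSequence N π = s.1} =
      ∑ a : NRComposition n r, compatibleCount s.1 a.1 * catenaryData n r N a := by
  have hfin : N.E.Finite := Set.finite_of_encard_eq_coe hE
  have hEfin : Finite N.E := hfin
  choose ℓ hℓ using fun X : {X : Fin (r + 1) → Set α // IsFlag N X} => X.2.exists_level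
  have hflags : Finite {X : Fin (r + 1) → Set α // IsFlag N X} := by
    refine Finite.of_injective (β := Fin (r + 1) → Set N.E) (fun X i => Subtype.val ⁻¹' X.1 i) ?_
    intro X Y hXY
    refine Subtype.ext (funext fun i => ?_)
    rw [← Set.inter_eq_right.2 (X.2.subset_ground i), ← Set.inter_eq_right.2 (Y.2.subset_ground i),
      ← Subtype.image_preimage_coe, ← Subtype.image_preimage_coe]
    exact congrArg _ (congrFun hXY i)
  have := Fintype.ofFinite {X : Fin (r + 1) → Set α // IsFlag N X}
  -- An ordering with rank sequence `s` is compatible with exactly one flag, formed by the closures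
  -- of its initial sets.
  have e : (Σ X : {X : Fin (r + 1) → Set α // IsFlag N X},
      {π : Fin n ≃ N.E // Compatible s.1 (ℓ X) π}) ≃
      {π : Fin n ≃ N.E // rankSequence N π = s.1} := by
    refine Equiv.ofBijective (fun x => ⟨x.2.1, (rankSequence_eq_iff hr _ _).2 fun m hm =>
      x.2.2.eRk_initialSet x.1.2 (hℓ x.1) hm⟩) ⟨?_, ?_⟩
    · rintro ⟨X, π, hπ⟩ ⟨Y, π', hπ'⟩ hXY
      obtain rfl : π = π' := congrArg Subtype.val hXY
      obtain rfl : X = Y := Subtype.ext (funext fun i => by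
        rw [hπ.closure_initialSet hr X.2 (hℓ X) i, hπ'.closure_initialSet hr Y.2 (hℓ Y) i])
      rfl
    · rintro ⟨π, hπ⟩
      rw [rankSequence_eq_iff hr] at hπ
      exact ⟨⟨⟨_, isFlag_closure_initialSet hr hπ⟩, π,
        compatible_of_eRk_initialSet (hℓ ⟨_, isFlag_closure_initialSet hr hπ⟩) hπ⟩, rfl⟩
  have hsub : ∀ (X : {X : Fin (r + 1) → Set α // IsFlag N X}) i, (X.1 i).Finite :=
    fun X i => hfin.subset (X.2.subset_ground i)
  rw [← Nat.card_congr e, Nat.card_sigma]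
  classical
  set comp : {X : Fin (r + 1) → Set α // IsFlag N X} → NRComposition n r :=
    fun X => ⟨flagComposition X.1, X.2.flagComposition_mem hE⟩ with hcomp
  rw [← Finset.sum_fiberwise Finset.univ comp]
  refine Finset.sum_congr rfl fun a _ => ?_
  have hcard : ∀ X ∈ Finset.univ.filter (fun X => comp X = a),
      Nat.card {π : Fin n ≃ N.E // Compatible s.1 (ℓ X) π} = compatibleCount s.1 a.1 := by
    intro X hX
    obtain rfl := (Finset.mem_filter.1 hX).2
    refine card_compatible _ _ _ fun i => ?_
    rw [partialSum_flagComposition X.2.strictMono.monotone (hsub X),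
      ← Set.ncard_image_of_injective _ Subtype.val_injective]
    congr 1
    ext x
    simp only [Set.mem_image, Set.mem_ofPred_eq, Subtype.exists, exists_and_right,
      exists_eq_right]
    constructor
    · rintro ⟨hx, h⟩; exact (hℓ X ⟨x, hx⟩ i).2 h
    · exact fun hx => ⟨X.2.subset_ground i hx, (hℓ X ⟨x, _⟩ i).1 hx⟩
  rw [Finset.sum_congr rfl hcard, Finset.sum_const, smul_eq_mul, mul_comm]
  congr 1
  rw [catenaryData, ← Set.ncard_coe_finset,
    ← Set.ncard_image_of_injective _ Subtype.val_injective]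
  congr 1
  ext X
  simp [hcomp, Subtype.ext_iff, and_comm]

end QConeCatenary

namespace QConeCatenary

variable {n r : ℕ}

/-! ### The `𝒢`-invariant determines the catenary data -/

lemma partialSum_castSucc_strictMono {a : Fin (r + 1) → ℕ} (ha : a ∈ compositions n r) :
    StrictMono (partialSum a) := by
  rw [Fin.strictMono_iff_lt_succ]
  intro i
  rw [partialSum_succ]
  have := (mem_compositions.1 ha).2 i.succ (Fin.succ_ne_zero i)
  omega

/-- The sequence `0 ⋯ 0 1 0 ⋯ 0 ⋯ 1 0 ⋯ 0` whose blocks have the lengths `a₀, …, aᵣ`. -/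
def blockSequence (n : ℕ) (a : Fin (r + 1) → ℕ) (p : Fin n) : ℕ :=
  if ∃ i : Fin r, partialSum a i.castSucc = p then 1 else 0

lemma prefixSum_blockSequence {a : Fin (r + 1) → ℕ} (ha : a ∈ compositions n r) {m : ℕ}
    (hm : m ≤ n) : prefixSum (blockSequence n a) m =
      (Finset.univ.filter fun i : Fin r => partialSum a i.castSucc < m).card := by
  induction m with
  | zero => simp [prefixSum_zero]
  | succ m ih =>
    have h1 := prefixSum_succ (blockSequence n a) ⟨m, hm⟩
    simp only at h1
    have h2 : (Finset.univ.filter fun i : Fin r => partialSum a i.castSucc < m + 1) =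
        (Finset.univ.filter fun i : Fin r => partialSum a i.castSucc < m) ∪
          (Finset.univ.filter fun i : Fin r => partialSum a i.castSucc = m) := by
      ext i
      simp only [Finset.mem_filter, Finset.mem_univ, true_and, Finset.mem_union]
      omega
    have h3 : Disjoint (Finset.univ.filter fun i : Fin r => partialSum a i.castSucc < m)
        (Finset.univ.filter fun i : Fin r => partialSum a i.castSucc = m) := by
      rw [Finset.disjoint_filter]; intro i _ h; omega
    rw [h1, ih (by omega), h2, Finset.card_union_of_disjoint h3]
    congr 1
    rw [blockSequence]
    split_ifs with h
    · obtain ⟨i, hi⟩ := h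
      symm
      rw [Finset.card_eq_one]
      refine ⟨i, ?_⟩
      ext k
      simp only [Finset.mem_filter, Finset.mem_univ, true_and, Finset.mem_singleton]
      constructor
      · intro hk
        exact Fin.castSucc_injective r
          ((partialSum_castSucc_strictMono ha).injective (hk.trans hi.symm))
      · rintro rfl; exact hi
    · symm
      rw [Finset.card_eq_zero, Finset.filter_eq_empty_iff]
      exact fun i _ hi => h ⟨i, hi⟩

/-- Counting places from 0, the first 1 after the initial `i` ones stands at place `partialSum a i`,
if there is one. -/
lemma prefixSum_blockSequence_le_iff {a : Fin (r + 1) → ℕ} (ha : a ∈ compositions n r) {m : ℕ}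
    (hm : m ≤ n) (i : Fin (r + 1)) :
    prefixSum (blockSequence n a) m ≤ i ↔ m ≤ partialSum a i := by
  have hmono := partialSum_castSucc_strictMono ha
  rw [prefixSum_blockSequence ha hm]
  constructor
  · intro h
    by_contra! hlt
    have hi : i ≠ Fin.last r := by
      rintro rfl
      rw [partialSum_last, (mem_compositions.1 ha).1] at hlt
      omega
    obtain ⟨i, rfl⟩ := Fin.exists_castSucc_eq.2 hi
    have hsub : Finset.Iic i ⊆
        Finset.univ.filter fun k : Fin r => partialSum a k.castSucc < m := fun k hk => by
      rw [Finset.mem_filter]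
      refine ⟨Finset.mem_univ _, lt_of_le_of_lt (hmono.monotone ?_) hlt⟩
      exact Fin.castSucc_le_castSucc_iff.2 (Finset.mem_Iic.1 hk)
    have := Finset.card_le_card hsub
    rw [Fin.card_Iic] at this
    simp only [Fin.val_castSucc] at h
    omega
  · intro h
    have hsub : (Finset.univ.filter fun k : Fin r => partialSum a k.castSucc < m) ⊆
        Finset.univ.filter fun k : Fin r => (k : ℕ) < i := fun k hk => by
      rw [Finset.mem_filter] at hk ⊢
      exact ⟨Finset.mem_univ _, hmono.lt_iff_lt.1 (hk.2.trans_le h)⟩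
    refine (Finset.card_le_card hsub).trans ?_
    rw [Fin.card_filter_val_lt]
    exact min_le_right _ _

lemma card_sigma_fst_le (b : Fin (r + 1) → ℕ) (i : Fin (r + 1)) :
    {t : Σ i, Fin (b i) | t.1 ≤ i}.ncard = partialSum b i := by
  have : {t : Σ i, Fin (b i) | t.1 ≤ i} =
      ((Finset.Iic i).sigma fun k => (Finset.univ : Finset (Fin (b k)))) := by
    ext t; simp
  rw [this, Set.ncard_coe_finset, Finset.card_sigma, partialSum]
  simp

lemma ncard_val_lt {n m : ℕ} (hm : m ≤ n) : {p : Fin n | (p : ℕ) < m}.ncard = m := by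
  have : {p : Fin n | (p : ℕ) < m} = (Finset.univ.filter fun p : Fin n => (p : ℕ) < m) := by
    ext p; simp
  rw [this, Set.ncard_coe_finset, Fin.card_filter_val_lt, min_eq_right hm]

lemma partialSum_le_of_mem {a : Fin (r + 1) → ℕ} (ha : a ∈ compositions n r) (i : Fin (r + 1)) :
    partialSum a i ≤ n := by
  rw [← (mem_compositions.1 ha).1, ← partialSum_last]
  exact partialSum_mono a (Fin.le_last i)

/-- The sequence with blocks `a` as an `(n, r)`-sequence. -/
def NRComposition.blockSequence (a : NRComposition n r) : NRSequence n r :=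
  ⟨QConeCatenary.blockSequence n a.1, fun p => by
    rw [QConeCatenary.blockSequence]; split_ifs <;> simp, by
    rw [← prefixSum_self, prefixSum_blockSequence a.2 le_rfl, Finset.filter_true_of_mem,
      Finset.card_univ, Fintype.card_fin]
    intro i _
    exact (partialSum_castSucc_strictMono a.2 (Fin.castSucc_lt_succ)).trans_le
      (partialSum_le_of_mem a.2 i.succ)⟩

/-- Triangularity: a compatible ordering puts its first `partialSum a i` elements into levels at
most `i`, which hold only `partialSum b i` elements. -/
lemma partialSum_le_of_compatibleCount_ne_zero (a b : NRComposition n r)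
    (h : compatibleCount a.blockSequence.1 b.1 ≠ 0) (i : Fin (r + 1)) :
    partialSum a.1 i ≤ partialSum b.1 i := by
  obtain ⟨⟨π, hπ⟩⟩ := (Nat.card_ne_zero.1 h).1
  rw [← card_sigma_fst_le b.1, ← ncard_val_lt (partialSum_le_of_mem a.2 i)]
  refine Set.ncard_le_ncard_of_injOn π (fun p hp => ?_) π.injective.injOn (Set.toFinite _)
  rw [Set.mem_ofPred_eq, Fin.le_def]
  exact (hπ p).1.trans ((prefixSum_blockSequence_le_iff a.2 p.2 i).2 hp)

/-- The diagonal entry: give each place the level equal to its own prefix sum; the block lengths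
make the level sizes equal to `a`. -/
lemma compatibleCount_self_ne_zero (a : NRComposition n r) :
    compatibleCount a.blockSequence.1 a.1 ≠ 0 := by
  set s := a.blockSequence
  set ℓ : Fin n → Fin (r + 1) := fun p =>
    ⟨prefixSum s.1 (p + 1), Nat.lt_succ_of_le (prefixSum_le s _)⟩ with hℓ
  obtain ⟨e, he⟩ := exists_equiv_sigma ℓ a.1 fun i => by
    conv_rhs => rw [← ncard_val_lt (partialSum_le_of_mem a.2 i)]
    congr 1
    ext p
    rw [Set.mem_ofPred_eq, Set.mem_ofPred_eq, Fin.le_def]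
    exact prefixSum_blockSequence_le_iff a.2 p.2 i
  refine Nat.card_ne_zero.2 ⟨⟨⟨e, fun p => ?_⟩⟩, inferInstance⟩
  rw [he]
  refine ⟨le_rfl, fun hp => ?_⟩
  change prefixSum s.1 p < prefixSum s.1 (p + 1)
  rw [prefixSum_succ, hp]
  omega

/-- The linear map from the catenary data to the `𝒢`-invariant is injective. -/
theorem eq_of_forall_sum_compatibleCount_eq {μ ν : NRComposition n r → ℕ}
    (h : ∀ s : NRSequence n r, ∑ a : NRComposition n r, compatibleCount s.1 a.1 * μ a =
      ∑ a : NRComposition n r, compatibleCount s.1 a.1 * ν a) : μ = ν := by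
  classical
  by_contra hne
  obtain ⟨a₀, ha₀⟩ := Function.ne_iff.1 hne
  -- Among the compositions where the data differ, take one with the largest total of partial sums.
  -- In the equation for its block sequence, any other composition with nonzero coefficient has a
  -- larger total, so the data agree there and only the term of `a` survives cancellation.
  obtain ⟨a, ha, hmax⟩ := Finset.exists_max_image
    (Finset.univ.filter fun a : NRComposition n r => μ a ≠ ν a) (fun a => ∑ i, partialSum a.1 i)
    ⟨a₀, by simpa using ha₀⟩
  have hrest : ∀ b ∈ Finset.univ.erase a,
      compatibleCount a.blockSequence.1 b.1 * μ b =
        compatibleCount a.blockSequence.1 b.1 * ν b := by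
    intro b hb
    by_cases h0 : compatibleCount a.blockSequence.1 b.1 = 0
    · rw [h0, zero_mul, zero_mul]
    · congr 1
      by_contra hb'
      have hle := partialSum_le_of_compatibleCount_ne_zero a b h0
      have hsum := hmax b (by simpa using hb')
      have heq := (Finset.sum_eq_sum_iff_of_le fun i _ => hle i).1
        (le_antisymm (Finset.sum_le_sum fun i _ => hle i) hsum)
      refine Finset.ne_of_mem_erase hb (Subtype.ext (partialSum_injective ?_))
      exact funext fun i => (heq i (Finset.mem_univ _)).symm
  have h1 := h a.blockSequence
  rw [← Finset.add_sum_erase _ _ (Finset.mem_univ a),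
    ← Finset.add_sum_erase _ (fun b : NRComposition n r => _ * ν b) (Finset.mem_univ a),
    Finset.sum_congr rfl hrest, Nat.add_right_cancel_iff] at h1
  exact (Finset.mem_filter.1 ha).2
    (Nat.eq_of_mul_eq_mul_left (Nat.pos_of_ne_zero (compatibleCount_self_ne_zero a)) h1)

/-- The `𝒢`-invariant with given catenary data. -/
noncomputable def gInvariantOfCatenaryData (𝕜 : Type*) [Field 𝕜] (ν : NRComposition n r → ℕ) :
    NRSequence n r → 𝕜 := fun s =>
  ((∑ a : NRComposition n r, compatibleCount s.1 a.1 * ν a : ℕ) : 𝕜)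

lemma gInvariantOfCatenaryData_injective (𝕜 : Type*) [Field 𝕜] [CharZero 𝕜] :
    Function.Injective (gInvariantOfCatenaryData 𝕜 (n := n) (r := r)) := fun _ _ h =>
  eq_of_forall_sum_compatibleCount_eq fun s => Nat.cast_injective (congrFun h s)

lemma gInvariant_eq {α : Type*} (𝕜 : Type*) [Field 𝕜] {N : Matroid α} (hE : N.E.encard = n)
    (hr : N.eRank = r) :
    gInvariant 𝕜 n r N = gInvariantOfCatenaryData 𝕜 (catenaryData n r N) :=
  funext fun s => by rw [gInvariant, card_rankSequence_eq hE hr s, gInvariantOfCatenaryData]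

end QConeCatenary

theorem mainTheorem12 (𝕜 : Type*) [Field 𝕜] [CharZero 𝕜] (q n r : ℕ) (hn : 0 < n) :
    ∃ Φ : (QConeCatenary.NRSequence n r → 𝕜) → (QConeCatenary.NRSequence (q * n + 1) (r + 1) → 𝕜),
      ∀ (K : Type*) [Field K] [Finite K] (V : Type*) [AddCommGroup V] [Module K V]
        (α : Type*) (M : Matroid α) (M' : Matroid (ℙ K V)),
        Nat.card K = q →
        QConeCatenary.IsSimple M → M.E.encard = n → M.eRank = r →
        QConeCatenary.IsQCone M M' →
        M'.E.encard = (q * n + 1 : ℕ) ∧ M'.eRank = (r + 1 : ℕ) ∧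
        QConeCatenary.catenaryData (q * n + 1) (r + 1) M' =
          QConeCatenary.coneCatenaryData q (QConeCatenary.catenaryData n r M) ∧
        QConeCatenary.gInvariant 𝕜 (q * n + 1) (r + 1) M' =
          Φ (QConeCatenary.gInvariant 𝕜 n r M) := by
  -- `Φ` recovers the catenary data from the invariant, applies the cone formula and re-encodes the
  -- result. The values of `Function.invFun` outside the range play no role.
  refine ⟨fun g => QConeCatenary.gInvariantOfCatenaryData 𝕜 (QConeCatenary.coneCatenaryData q
    (Function.invFun (QConeCatenary.gInvariantOfCatenaryData 𝕜) g)), ?_⟩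
  intro K _ _ V _ _ α M M' hq _ hE hr hcone
  obtain ⟨hE', hr', hcat⟩ := hcone.catenaryData_eq hn hq hE hr
  refine ⟨hE', hr', hcat, ?_⟩
  rw [QConeCatenary.gInvariant_eq 𝕜 hE' hr', QConeCatenary.gInvariant_eq 𝕜 hE hr, hcat]
  beta_reduce
  rw [Function.leftInverse_invFun (QConeCatenary.gInvariantOfCatenaryData_injective 𝕜)]
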